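/- Let $0<q<1$ and let $N\ge 2$ be an integer. The quiver $Q_N$ has vertices $(i,j)$, $1\le i<j\le N$, and directed edges from $(i,j)$ to $(i,j+1)$, from $(i,j)$ to $(i+1,j)$, and from $(i+1,j+1)$ to $(i,j)$. Its incidence matrix $B$ is skew-symmetric, with $B_{v,w}=1$ if there is an edge from $v$ to $w$, $B_{v,w}=-1$ if there is an edge from $w$ to $v$, and $B_{v,w}=0$ otherwise. Let $\mathcal T_N$ be the unital associative $\mathbb R$-algebra with generators $\mathsf Z_{ij}$, $1\le i<j\le N$, and defining relations $\mathsf Z_v\mathsf Z_w=q^{B_{v,w}}\,\mathsf Z_w\mathsf Z_v$, and let $\widehat{\mathcal T}_N$ be the algebra of formal series in these generators, i.e. the completion $\varprojlim_n \mathcal T_N/\mathcal I^n$, where $\mathcal I$ is the two-sided ideal generated by all $\mathsf Z_{ij}$. For $x\in\mathcal I$ let $$\Psi(x)=\sum_{n=0}^{\infty}\frac{(-x)^n}{(1-q)\cdots(1-q^n)}\in\widehat{\mathcal T}_N .$$ Let $\Lambda_N=\{(a,b,c)\in\mathbb Z^3 : 1\le a<b<c\le N+1\}$, and define $$\mathsf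 T_N=\prod^{\rightarrow}_{(a,b,c)\in\Lambda_N}\Psi\bigl(\mathsf Z_{a,b}\,\mathsf Z_{a+1,b+1}\cdots \mathsf Z_{a+c-b-1,\,c-1}\bigr)\in\widehat{\mathcal T}_N ,$$ the product over $\Lambda_N$ in lexicographic order, increasing from left to right. Let $\rho$ be the automorphism, and $\mu_1,\mu_2,\mu_3$ the anti-automorphisms, of $\mathcal T_N$ given by $$\rho(\mathsf Z_{ij})=\mathsf Z_{j-i,\,N+1-i},\quad \mu_1(\mathsf Z_{ij})=\mathsf Z_{j-i,\,j},\quad \mu_2(\mathsf Z_{ij})=\mathsf Z_{N+1-j,\,N+1-i},\quad \mu_3(\mathsf Z_{ij})=\mathsf Z_{i,\,N+1+i-j},$$ extended to $\widehat{\mathcal T}_N$ by acting on formal series term by term. Then $$\mathsf T_N=\mu_1(\mathsf T_N)=\mu_2(\mathsf T_N)=\mu_3(\mathsf T_N),\qquad \mathsf T_N=\rho(\mathsf T_N)=\rho(\rho(\mathsf T_N)).$$ Moreover, the number of factors in $\mathsf T_N$ is $|\Lambda_N|=\binom{N+1}{3}$, so that these are identities of type $\binom{N+1}{3}\sim\binom{N+1}{3}$.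 -/

import Mathlib

noncomputable section

namespace QDilog

/-! ### Lexicographically ordered products -/

/-- The ordered product of the non-commuting factors `f i`, `i ∈ s`, in which `f i` stands to the
right of all `f j` with `j < i`. -/
def orderedProd {ι M : Type*} [LinearOrder ι] [Monoid M] (s : Finset ι) (f : {i // i ∈ s} → M) :
    M :=
  (s.attach.sort.map f).prod

/-! ### Formal series: completion with respect to the powers of a two-sided ideal -/

section Completion

variable {A : Type} [Ring A] [Algebra ℝ A] (I : Ideal A) [I.IsTwoSided]

/-- The inverse limit of the algebras `A ⧸ I ^ n`, for a two-sided ideal `I` of a (possibly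
non-commutative) real algebra `A`, as the algebra of compatible sequences. -/
def Completion : Subalgebra ℝ (∀ n : ℕ, A ⧸ I ^ n) where
  carrier := {x | ∀ m n : ℕ, ∀ h : m ≤ n,
    Ideal.Quotient.factorₐ ℝ (Ideal.pow_le_pow_right h : I ^ n ≤ I ^ m) (x n) = x m}
  mul_mem' hx hy m n h := by simp only [Pi.mul_apply, map_mul, hx m n h, hy m n h]
  add_mem' hx hy m n h := by simp only [Pi.add_apply, map_add, hx m n h, hy m n h]
  algebraMap_mem' r m n h := by simp only [Pi.algebraMap_apply, AlgHom.commutes]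

/-- The coefficient `(-1)ⁿ / ((1 - q) ⋯ (1 - qⁿ))` of the quantum exponential. -/
def qExpCoeff (q : ℝ) (n : ℕ) : ℝ := (-1) ^ n / ∏ k ∈ Finset.range n, (1 - q ^ (k + 1))

/-- The quantum exponential `Ψ(x) = ∑ₙ (-x)ⁿ / ((1 - q) ⋯ (1 - qⁿ))` of an element `x ∈ I`, as an
element of the completion: as `x ^ k ∈ I ^ n` for `k ≥ n`, only the terms with `k < n` contribute
modulo `I ^ n`. -/
def qExp (q : ℝ) (x : A) (hx : x ∈ I) : Completion I :=
  ⟨fun n => Ideal.Quotient.mkₐ ℝ (I ^ n) (∑ k ∈ Finset.range n, qExpCoeff q k • x ^ k), by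
    intro m n h
    change Ideal.Quotient.mk (I ^ m) _ = Ideal.Quotient.mk (I ^ m) _
    rw [Ideal.Quotient.mk_eq_mk_iff_sub_mem, ← Finset.sum_range_add_sum_Ico _ h,
      add_sub_cancel_left]
    refine Submodule.sum_mem _ fun k hk => ?_
    rw [Algebra.smul_def]
    exact Ideal.mul_mem_left _ _
      (Ideal.pow_le_pow_right (Finset.mem_Ico.1 hk).1 (Ideal.pow_mem_pow hx k))⟩

variable {I}

theorem map_pow_mem {J : Ideal A} (f : A →ₐ[ℝ] A) (hf : ∀ x ∈ J, f x ∈ J) (n : ℕ) :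
    ∀ x ∈ J ^ n, f x ∈ J ^ n := by
  induction n with
  | zero => intro x _; rw [Submodule.pow_zero, Ideal.one_eq_top]; trivial
  | succ n ih =>
    intro x hx
    rw [Submodule.pow_succ] at hx
    refine Submodule.mul_induction_on hx (fun a ha b hb => ?_) (fun a b ha hb => ?_)
    · rw [map_mul, Submodule.pow_succ]
      exact Ideal.mul_mem_mul (ih a ha) (hf b hb)
    · rw [map_add]
      exact Ideal.add_mem _ ha hb

open MulOpposite in
theorem antiMap_pow_mem (f : A →ₐ[ℝ] Aᵐᵒᵖ) (hf : ∀ x ∈ I, unop (f x) ∈ I) (n : ℕ) :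
    ∀ x ∈ I ^ n, unop (f x) ∈ I ^ n := by
  induction n with
  | zero => intro x _; rw [Submodule.pow_zero, Ideal.one_eq_top]; trivial
  | succ n ih =>
    intro x hx
    rw [Submodule.pow_succ] at hx
    refine Submodule.mul_induction_on hx (fun a ha b hb => ?_) (fun a b ha hb => ?_)
    · rw [map_mul, unop_mul, Ideal.IsTwoSided.pow_succ]
      exact Ideal.mul_mem_mul (hf b hb) (ih a ha)
    · rw [map_add, unop_add]
      exact Ideal.add_mem _ ha hb

/-- The extension to formal series of an algebra endomorphism preserving `I`: it acts on the
component in `A ⧸ I ^ n` by `[a] ↦ [f a]`. -/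
def completionMap (f : A →ₐ[ℝ] A) (hf : ∀ x ∈ I, f x ∈ I) : Completion I →ₐ[ℝ] Completion I :=
  let F (n : ℕ) : (A ⧸ I ^ n) →ₐ[ℝ] (A ⧸ I ^ n) :=
    Ideal.Quotient.liftₐ (I ^ n) ((Ideal.Quotient.mkₐ ℝ (I ^ n)).comp f) fun a ha =>
      Ideal.Quotient.eq_zero_iff_mem.2 (map_pow_mem f hf n a ha)
  ((AlgHom.pi fun n =>
    (F n).comp ((Pi.evalAlgHom ℝ (fun n : ℕ => A ⧸ I ^ n) n).comp
      (Completion I).val)).codRestrict (Completion I) (by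
    intro x m n h
    have hx := x.2 m n h
    obtain ⟨a, ha⟩ := Ideal.Quotient.mk_surjective (x.1 n)
    change Ideal.Quotient.factorₐ ℝ _ (F n (x.1 n)) = F m (x.1 m)
    rw [← hx, ← ha]
    rfl))

open MulOpposite in
/-- The extension to formal series of an anti-endomorphism preserving `I` (given as a homomorphism
to the opposite algebra): it acts on the component in `A ⧸ I ^ n` by `[a] ↦ [f a]`. -/
def completionAntiMap (f : A →ₐ[ℝ] Aᵐᵒᵖ) (hf : ∀ x ∈ I, unop (f x) ∈ I) :
    Completion I →ₐ[ℝ] (Completion I)ᵐᵒᵖ :=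
  let F (n : ℕ) : (A ⧸ I ^ n) →ₐ[ℝ] (A ⧸ I ^ n)ᵐᵒᵖ :=
    Ideal.Quotient.liftₐ (I ^ n) ((AlgHom.op (Ideal.Quotient.mkₐ ℝ (I ^ n))).comp f) fun a ha =>
      unop_injective (Ideal.Quotient.eq_zero_iff_mem.2 (antiMap_pow_mem f hf n a ha))
  AlgHom.ofLinearMap
    { toFun := fun x => op ⟨fun n => unop (F n (x.1 n)), by
        intro m n h
        have hx := x.2 m n h
        obtain ⟨a, ha⟩ := Ideal.Quotient.mk_surjective (x.1 n)
        change Ideal.Quotient.factorₐ ℝ _ (unop (F n (x.1 n))) = unop (F m (x.1 m))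
        rw [← hx, ← ha]
        rfl⟩
      map_add' := fun x y => unop_injective (Subtype.ext (funext fun n =>
        congrArg unop (map_add (F n) (x.1 n) (y.1 n))))
      map_smul' := fun r x => unop_injective (Subtype.ext (funext fun n =>
        congrArg unop (map_smul (F n) r (x.1 n)))) }
    (unop_injective (Subtype.ext (funext fun n => congrArg unop (map_one (F n)))))
    (fun x y => unop_injective (Subtype.ext (funext fun n =>
        congrArg unop (map_mul (F n) (x.1 n) (y.1 n)))))

end Completion

/-! ### The triangular quiver and its algebra -/

/-- Vertices of the quiver `Q_N`: pairs `(i, j)` with `1 ≤ i < j ≤ N`. -/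
def Vertex (N : ℕ) : Type := {p : ℕ × ℕ // 1 ≤ p.1 ∧ p.1 < p.2 ∧ p.2 ≤ N}

/-- There is a directed edge from `v` to `w`: the edges go from `(i, j)` to `(i, j + 1)`,
from `(i, j)` to `(i + 1, j)`, and from `(i + 1, j + 1)` to `(i, j)`. -/
def Edge {N : ℕ} (v w : Vertex N) : Prop :=
  (w.1.1 = v.1.1 ∧ w.1.2 = v.1.2 + 1) ∨ (w.1.1 = v.1.1 + 1 ∧ w.1.2 = v.1.2) ∨
    (v.1.1 = w.1.1 + 1 ∧ v.1.2 = w.1.2 + 1)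

open Classical in
/-- The skew-symmetric incidence matrix of the quiver. -/
def incidence {N : ℕ} (v w : Vertex N) : ℤ :=
  if Edge v w then 1 else if Edge w v then -1 else 0

/-- The defining relations `Z_v Z_w = q ^ B(v, w) Z_w Z_v`. -/
inductive Rel (q : ℝ) (N : ℕ) : FreeAlgebra ℝ (Vertex N) → FreeAlgebra ℝ (Vertex N) → Prop
  | comm (v w : Vertex N) :
      Rel q N (FreeAlgebra.ι ℝ v * FreeAlgebra.ι ℝ w)
        (q ^ incidence v w • (FreeAlgebra.ι ℝ w * FreeAlgebra.ι ℝ v))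

/-- The algebra `𝒯_N` given by generators `Z_v` and the relations above. -/
def QuiverAlg (q : ℝ) (N : ℕ) : Type := RingQuot (Rel q N)

instance (q : ℝ) (N : ℕ) : Ring (QuiverAlg q N) := inferInstanceAs (Ring (RingQuot (Rel q N)))

instance (q : ℝ) (N : ℕ) : Algebra ℝ (QuiverAlg q N) :=
  inferInstanceAs (Algebra ℝ (RingQuot (Rel q N)))

/-- The generators `Z_v`. -/
def Z (q : ℝ) {N : ℕ} (v : Vertex N) : QuiverAlg q N :=
  RingQuot.mkAlgHom ℝ (Rel q N) (FreeAlgebra.ι ℝ v)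

theorem Z_mul_Z (q : ℝ) {N : ℕ} (v w : Vertex N) :
    Z q v * Z q w = q ^ incidence v w • (Z q w * Z q v) := by
  have h := RingQuot.mkAlgHom_rel ℝ (Rel.comm (q := q) v w)
  rw [map_mul, map_smul, map_mul] at h
  exact h

section Lift

variable {q : ℝ} {N : ℕ} {B : Type} [Ring B] [Algebra ℝ B]

/-- The homomorphism from `𝒯_N` with prescribed values on the generators. -/
def liftGen (g : Vertex N → B) (hg : ∀ v w, g v * g w = q ^ incidence v w • (g w * g v)) :
    QuiverAlg q N →ₐ[ℝ] B :=
  RingQuot.liftAlgHom ℝ ⟨FreeAlgebra.lift ℝ g, by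
    rintro _ _ ⟨v, w⟩
    simpa using hg v w⟩

theorem liftGen_Z (g : Vertex N → B)
    (hg : ∀ v w, g v * g w = q ^ incidence v w • (g w * g v)) (v : Vertex N) :
    liftGen g hg (Z q v) = g v := by
  simp only [liftGen, Z]
  erw [RingQuot.liftAlgHom_mkAlgHom_apply]
  simp

theorem hom_ext {f g : QuiverAlg q N →ₐ[ℝ] B} (h : ∀ v, f (Z q v) = g (Z q v)) : f = g :=
  RingQuot.ringQuot_ext' ℝ f g (FreeAlgebra.hom_ext (funext h))

end Lift

/-- The homomorphism `𝒯_N → ℝ` taking the constant term, `Z_v ↦ 0`. -/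
def constTerm (q : ℝ) (N : ℕ) : QuiverAlg q N →ₐ[ℝ] ℝ :=
  liftGen (fun _ => 0) (by simp)

/-- The ideal of the elements of `𝒯_N` without constant term. -/
def augIdeal (q : ℝ) (N : ℕ) : Ideal (QuiverAlg q N) := RingHom.ker (constTerm q N)

instance (q : ℝ) (N : ℕ) : (augIdeal q N).IsTwoSided :=
  inferInstanceAs (RingHom.ker (constTerm q N)).IsTwoSided

theorem Z_mem_augIdeal (q : ℝ) {N : ℕ} (v : Vertex N) : Z q v ∈ augIdeal q N :=
  liftGen_Z _ _ v

/-- The algebra of formal series in the generators of `𝒯_N`: the completion of `𝒯_N` with respect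
to the powers of the ideal generated by the `Z_v`. -/
abbrev QuiverSeries (q : ℝ) (N : ℕ) : Type := Completion (augIdeal q N)

/-! ### Symmetries -/

/-- `(i, j) ↦ (j - i, N + 1 - i)` -/
def rotVertex {N : ℕ} (v : Vertex N) : Vertex N :=
  ⟨(v.1.2 - v.1.1, N + 1 - v.1.1), by have := v.2; dsimp only; omega⟩

/-- `(i, j) ↦ (j - i, j)` -/
def refl₁Vertex {N : ℕ} (v : Vertex N) : Vertex N :=
  ⟨(v.1.2 - v.1.1, v.1.2), by have := v.2; dsimp only; omega⟩

/-- `(i, j) ↦ (N + 1 - j, N + 1 - i)` -/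
def refl₂Vertex {N : ℕ} (v : Vertex N) : Vertex N :=
  ⟨(N + 1 - v.1.2, N + 1 - v.1.1), by have := v.2; dsimp only; omega⟩

/-- `(i, j) ↦ (i, N + 1 + i - j)` -/
def refl₃Vertex {N : ℕ} (v : Vertex N) : Vertex N :=
  ⟨(v.1.1, N + 1 + v.1.1 - v.1.2), by have := v.2; dsimp only; omega⟩

theorem incidence_congr {N : ℕ} {v w v' w' : Vertex N} (h₁ : Edge v w ↔ Edge v' w')
    (h₂ : Edge w v ↔ Edge w' v') : incidence v w = incidence v' w' := by
  classical
  unfold incidence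
  split_ifs <;> simp_all

theorem edge_rot {N : ℕ} (v w : Vertex N) : Edge (rotVertex v) (rotVertex w) ↔ Edge v w := by
  have := v.2; have := w.2; simp only [Edge, rotVertex]; omega

theorem edge_refl₁ {N : ℕ} (v w : Vertex N) :
    Edge (refl₁Vertex v) (refl₁Vertex w) ↔ Edge w v := by
  have := v.2; have := w.2; simp only [Edge, refl₁Vertex]; omega

theorem edge_refl₂ {N : ℕ} (v w : Vertex N) :
    Edge (refl₂Vertex v) (refl₂Vertex w) ↔ Edge w v := by
  have := v.2; have := w.2; simp only [Edge, refl₂Vertex]; omega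

theorem edge_refl₃ {N : ℕ} (v w : Vertex N) :
    Edge (refl₃Vertex v) (refl₃Vertex w) ↔ Edge w v := by
  have := v.2; have := w.2; simp only [Edge, refl₃Vertex]; omega

/-- The homomorphism of `𝒯_N` induced by a vertex map preserving the arrows. -/
def homOfVertexMap (q : ℝ) {N : ℕ} (s : Vertex N → Vertex N)
    (hs : ∀ v w, Edge (s v) (s w) ↔ Edge v w) : QuiverAlg q N →ₐ[ℝ] QuiverAlg q N :=
  liftGen (fun v => Z q (s v)) fun v w => by
    rw [Z_mul_Z, incidence_congr (hs v w) (hs w v)]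

open MulOpposite in
/-- The anti-homomorphism of `𝒯_N` induced by a vertex map reversing the arrows. -/
def antiHomOfVertexMap (q : ℝ) {N : ℕ} (s : Vertex N → Vertex N)
    (hs : ∀ v w, Edge (s v) (s w) ↔ Edge w v) : QuiverAlg q N →ₐ[ℝ] (QuiverAlg q N)ᵐᵒᵖ :=
  liftGen (fun v => op (Z q (s v))) fun v w => by
    rw [← op_mul, ← op_mul, Z_mul_Z, incidence_congr (hs w v) (hs v w), op_smul]

/-- The action on formal series of a vertex map preserving the arrows. -/
def seriesHom (q : ℝ) {N : ℕ} (s : Vertex N → Vertex N)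
    (hs : ∀ v w, Edge (s v) (s w) ↔ Edge v w) : QuiverSeries q N →ₐ[ℝ] QuiverSeries q N :=
  completionMap (homOfVertexMap q s hs) fun x hx => by
    have h : (constTerm q N).comp (homOfVertexMap q s hs) = constTerm q N :=
      hom_ext fun v => by
        simp only [AlgHom.comp_apply, homOfVertexMap, constTerm, liftGen_Z]
    exact (DFunLike.congr_fun h x).trans hx

open MulOpposite in
/-- The action on formal series of a vertex map reversing the arrows. -/
def seriesAntiHom (q : ℝ) {N : ℕ} (s : Vertex N → Vertex N)
    (hs : ∀ v w, Edge (s v) (s w) ↔ Edge w v) :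
    QuiverSeries q N →ₐ[ℝ] (QuiverSeries q N)ᵐᵒᵖ :=
  completionAntiMap (antiHomOfVertexMap q s hs) fun x hx => by
    have h : (AlgHom.op (constTerm q N)).comp (antiHomOfVertexMap q s hs) =
        (AlgEquiv.toOpposite ℝ ℝ).toAlgHom.comp (constTerm q N) :=
      hom_ext fun v => unop_injective (by
        simp [antiHomOfVertexMap, constTerm, liftGen_Z])
    exact (congrArg unop (DFunLike.congr_fun h x)).trans hx

/-- The automorphism `ρ`, `Z_{ij} ↦ Z_{j - i, N + 1 - i}`, on formal series. -/
def rho (q : ℝ) (N : ℕ) : QuiverSeries q N →ₐ[ℝ] QuiverSeries q N :=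
  seriesHom q rotVertex edge_rot

/-- The anti-automorphism `μ₁`, `Z_{ij} ↦ Z_{j - i, j}`, on formal series. -/
def mu₁ (q : ℝ) (N : ℕ) : QuiverSeries q N →ₐ[ℝ] (QuiverSeries q N)ᵐᵒᵖ :=
  seriesAntiHom q refl₁Vertex edge_refl₁

/-- The anti-automorphism `μ₂`, `Z_{ij} ↦ Z_{N + 1 - j, N + 1 - i}`, on formal series. -/
def mu₂ (q : ℝ) (N : ℕ) : QuiverSeries q N →ₐ[ℝ] (QuiverSeries q N)ᵐᵒᵖ :=
  seriesAntiHom q refl₂Vertex edge_refl₂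

/-- The anti-automorphism `μ₃`, `Z_{ij} ↦ Z_{i, N + 1 + i - j}`, on formal series. -/
def mu₃ (q : ℝ) (N : ℕ) : QuiverSeries q N →ₐ[ℝ] (QuiverSeries q N)ᵐᵒᵖ :=
  seriesAntiHom q refl₃Vertex edge_refl₃

/-! ### The element `T_N` -/

/-- The discrete tetrahedron `Λ_N` of triples `1 ≤ a < b < c ≤ N + 1`, with the lexicographic
order of `ℕ ×ₗ ℕ ×ₗ ℕ`. -/
def tetrahedron (N : ℕ) : Finset (ℕ ×ₗ ℕ ×ₗ ℕ) :=
  (((Finset.Icc 1 (N + 1) ×ˢ Finset.Icc 1 (N + 1) ×ˢ Finset.Icc 1 (N + 1)).filter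
    fun p => p.1 < p.2.1 ∧ p.2.1 < p.2.2).image fun p => toLex (p.1, toLex (p.2.1, p.2.2)))

theorem mem_tetrahedron {N a b c : ℕ} :
    toLex (a, toLex (b, c)) ∈ tetrahedron N ↔ 1 ≤ a ∧ a < b ∧ b < c ∧ c ≤ N + 1 := by
  simp only [tetrahedron, Finset.mem_image, Finset.mem_filter, Finset.mem_product,
    Finset.mem_Icc, Prod.exists, EmbeddingLike.apply_eq_iff_eq, Prod.mk.injEq]
  constructor
  · rintro ⟨a, b, c, h, rfl, rfl, rfl⟩; omega
  · intro h; exact ⟨a, b, c, by omega, rfl, rfl, rfl⟩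

/-- The ordered monomial `Z_{a,b} Z_{a+1,b+1} ⋯ Z_{a+c-b-1,c-1}`. -/
def monomial (q : ℝ) {N a b c : ℕ} (h : 1 ≤ a ∧ a < b ∧ b < c ∧ c ≤ N + 1) : QuiverAlg q N :=
  orderedProd (Finset.Icc 0 (c - b - 1)) fun k =>
    Z q (⟨(a + k.1, b + k.1), by have := Finset.mem_Icc.1 k.2; dsimp only; omega⟩ : Vertex N)

theorem monomial_mem (q : ℝ) {N a b c : ℕ} (h : 1 ≤ a ∧ a < b ∧ b < c ∧ c ≤ N + 1) :
    monomial q h ∈ augIdeal q N := by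
  have key : constTerm q N (monomial q h) = 0 := by
    rw [monomial, orderedProd, map_list_prod, List.prod_eq_zero_iff, List.map_map, List.mem_map]
    exact ⟨⟨0, by simp⟩, (Finset.mem_sort _).2 (Finset.mem_attach _ _), Z_mem_augIdeal q _⟩
  exact key

/-- The factor `Ψ(Z_{a,b} Z_{a+1,b+1} ⋯ Z_{a+c-b-1,c-1})` attached to the point `(a, b, c)`. -/
def tetraFactor (q : ℝ) (N : ℕ) (p : {p // p ∈ tetrahedron N}) : QuiverSeries q N :=
  qExp (augIdeal q N) q _
    (monomial_mem q (N := N) (a := (ofLex p.1).1) (b := (ofLex (ofLex p.1).2).1)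
      (c := (ofLex (ofLex p.1).2).2) (mem_tetrahedron.1 p.2))

/-- The element `T_N`: the lexicographically ordered product of the factors over `Λ_N`. -/
def T (q : ℝ) (N : ℕ) : QuiverSeries q N := orderedProd (tetrahedron N) (tetraFactor q N)

end QDilog

end

/-! Two formal series agree once they agree modulo every power `I ^ n` of the augmentation ideal.
There the generators lie in an ideal `J` with `J ^ n = ⊥`, the quantum exponentials become finite
sums, and their classical identities hold exactly.

Only two symmetries need work, since `ρ = μ₂ ∘ μ₃` and `μ₁ = μ₃ ∘ ρ` already hold on vertices.

For `μ₂`, the reflection maps diagonal chains to diagonal chains, hence permutes the factors of `T`.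
It reverses the lexicographic order up to pairs of factors whose chains commute
(`IsGridRep.commute_diagChain`).

For `μ₃`, chains with a common start `(a, b)` satisfy `v u = q u v`, so by Schützenberger's formula
their exponentials multiply to `Ψ(D a b)`, where `D a b` is the sum of these chains. Thus `T` is a
product of rows of exponentials of diagonal sums. Let `P a` be the product of the rows from `a` on,
and `C a b` the corresponding sum of chains along a column. The heart of the proof is `D a b * P (a
+ 1) = P (a + 1) * C a b` (`IsGridRep.diagSum_mul_rowsProd`): by the pentagon identity, conjugating
by one row turns one diagonal step into a vertical step. Hence row `a` can be moved from the left of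
`P (a + 1)` to its right, with `D` replaced by `C`. As `μ₃` exchanges diagonals with columns and
reverses products, `μ₃ (P a) = P a` follows by induction on the number of rows. -/

noncomputable section

namespace QDilog

/-! ### Truncated quantum exponentials in a ring with a nilpotent ideal -/

section Truncated

variable {R : Type*} [Ring R] [Algebra ℝ R]

/-- The sum of the first `n` terms of the quantum exponential. -/
def qExpTrunc (q : ℝ) (n : ℕ) (x : R) : R := ∑ k ∈ Finset.range n, qExpCoeff q k • x ^ k

/-- The functional equation `Ψ(q x) = Ψ(x) (1 + x)` read on coefficients; it drives all the
inductions on degree below. -/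
theorem qExpCoeff_succ {q : ℝ} (hq₀ : 0 < q) (hq₁ : q < 1) (k : ℕ) :
    (1 - q ^ (k + 1)) * qExpCoeff q (k + 1) = -qExpCoeff q k := by
  have h : ∀ m : ℕ, 1 - q ^ (m + 1) ≠ 0 := fun m =>
    (sub_pos.2 (pow_lt_one₀ hq₀.le hq₁ m.succ_ne_zero)).ne'
  have hp : ∏ m ∈ Finset.range k, (1 - q ^ (m + 1)) ≠ 0 := Finset.prod_ne_zero_iff.2 fun m _ => h m
  have := h k
  rw [qExpCoeff, qExpCoeff, Finset.prod_range_succ]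
  field_simp
  ring

/-- Semiconjugation passes to powers and sums. Every conjugation below is phrased this way, so that
no inverse is needed. -/
theorem SemiconjBy.qExpTrunc (q : ℝ) (n : ℕ) {t x y : R} (h : SemiconjBy t x y) :
    SemiconjBy t (qExpTrunc q n x) (qExpTrunc q n y) := by
  simp only [SemiconjBy, QDilog.qExpTrunc, Finset.mul_sum, Finset.sum_mul, mul_smul_comm,
    smul_mul_assoc]
  exact Finset.sum_congr rfl fun k _ => by rw [(h.pow_right k).eq]

theorem Commute.qExpTrunc (q : ℝ) (n : ℕ) {t x : R} (h : Commute t x) :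
    Commute t (qExpTrunc q n x) :=
  SemiconjBy.qExpTrunc q n h

variable {J : Ideal R} [J.IsTwoSided] {n : ℕ}

omit [Algebra ℝ R] in
theorem pow_mul_pow_eq_zero (hJ : J ^ n = ⊥) {u v : R} (hu : u ∈ J) (hv : v ∈ J) {i j : ℕ}
    (h : n ≤ i + j) : u ^ i * v ^ j = 0 := by
  have : u ^ i * v ^ j ∈ J ^ (i + j) := by
    rw [Ideal.IsTwoSided.pow_add]
    exact Ideal.mul_mem_mul (Ideal.pow_mem_pow hu i) (Ideal.pow_mem_pow hv j)
  have := Ideal.pow_le_pow_right h this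
  rwa [hJ] at this

omit [J.IsTwoSided] in
theorem qExpTrunc_zero (hJ : J ^ n = ⊥) (q : ℝ) : qExpTrunc q n (0 : R) = 1 := by
  cases n with
  | zero =>
    -- Here `⊤ = ⊥`, so the ring is trivial and the empty sum is `1`.
    rw [Submodule.pow_zero, Ideal.one_eq_top] at hJ
    have : (1 : R) ∈ (⊥ : Ideal R) := hJ ▸ Submodule.mem_top
    rw [Ideal.mem_bot] at this
    simp [qExpTrunc, this]
  | succ n => simp [qExpTrunc, Finset.sum_range_succ', qExpCoeff]

/-- The `q`-binomial theorem, with the `q`-factorials absorbed into the coefficients. -/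
theorem qExpCoeff_smul_add_pow {q : ℝ} (hq₀ : 0 < q) (hq₁ : q < 1) {u v : R} (h : v * u = q • (u * v)) (k : ℕ) :
    qExpCoeff q k • (u + v) ^ k = ∑ p ∈ Finset.HasAntidiagonal.antidiagonal k,
      (qExpCoeff q p.1 • u ^ p.1) * (qExpCoeff q p.2 • v ^ p.2) := by
  have hvu : ∀ i : ℕ, v * u ^ i = q ^ i • (u ^ i * v) := by
    intro i
    induction i with
    | zero => simp
    | succ i ih =>
      rw [pow_succ, ← mul_assoc, ih, smul_mul_assoc, mul_assoc, h, mul_smul_comm, smul_smul,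
        mul_assoc, pow_succ]
  induction k with
  | zero => simp [qExpCoeff]
  | succ k ih =>
    have hk : 1 - q ^ (k + 1) ≠ 0 := (sub_pos.2 (pow_lt_one₀ hq₀.le hq₁ k.succ_ne_zero)).ne'
    apply smul_right_injective R hk
    dsimp only
    rw [smul_smul, qExpCoeff_succ hq₀ hq₁, pow_succ', neg_smul, ← mul_smul_comm, ih, Finset.mul_sum]
    -- The split `1 - q ^ (i + j) = (1 - q ^ i) + q ^ i * (1 - q ^ j)` lets the coefficient
    -- recursion lower `i` in the first part and `j` in the second; `q ^ i` is the cost of moving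
    -- `v` past `u ^ i`.
    have key : ∀ p ∈ Finset.HasAntidiagonal.antidiagonal (k + 1),
        (1 - q ^ (k + 1)) • ((qExpCoeff q p.1 • u ^ p.1) * (qExpCoeff q p.2 • v ^ p.2)) =
        (1 - q ^ p.1) • ((qExpCoeff q p.1 • u ^ p.1) * (qExpCoeff q p.2 • v ^ p.2)) +
        (q ^ p.1 * (1 - q ^ p.2)) •
          ((qExpCoeff q p.1 • u ^ p.1) * (qExpCoeff q p.2 • v ^ p.2)) := by
      intro p hp
      rw [← add_smul, ← Finset.HasAntidiagonal.mem_antidiagonal.1 hp, pow_add]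
      congr 1
      ring
    rw [Finset.smul_sum, Finset.sum_congr rfl key, Finset.sum_add_distrib,
      Finset.Nat.sum_antidiagonal_succ, Finset.Nat.sum_antidiagonal_succ']
    simp only [pow_zero, sub_self, zero_smul, mul_zero, zero_add]
    rw [← Finset.sum_add_distrib, ← Finset.sum_neg_distrib]
    refine Finset.sum_congr rfl fun p _ => ?_
    have e₁ := qExpCoeff_succ hq₀ hq₁ p.1
    have e₂ := qExpCoeff_succ hq₀ hq₁ p.2
    simp only [smul_mul_assoc, mul_smul_comm, smul_smul, add_mul, ← mul_assoc, hvu, smul_add,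
      ← pow_succ']
    rw [mul_assoc (u ^ p.1), ← pow_succ']
    match_scalars
    · linear_combination -qExpCoeff q p.2 * e₁
    · linear_combination -q ^ p.1 * qExpCoeff q p.1 * e₂

/-- Schützenberger's addition formula. -/
theorem qExpTrunc_add (hJ : J ^ n = ⊥) {q : ℝ} (hq₀ : 0 < q) (hq₁ : q < 1) {u v : R} (hu : u ∈ J)
    (hv : v ∈ J) (h : v * u = q • (u * v)) :
    qExpTrunc q n (u + v) = qExpTrunc q n u * qExpTrunc q n v := by
  rw [qExpTrunc, qExpTrunc, qExpTrunc, Finset.sum_mul_sum, ← Finset.sum_product',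
    ← Finset.sum_filter_add_sum_filter_not _ (fun p : ℕ × ℕ => p.1 + p.2 < n)]
  rw [Finset.sum_eq_zero (s := Finset.filter (fun p : ℕ × ℕ => ¬ _) _)]
  · rw [add_zero, ← Finset.sum_fiberwise_of_maps_to (g := fun p : ℕ × ℕ => p.1 + p.2)
      (t := Finset.range n) (fun p hp => Finset.mem_range.2 (Finset.mem_filter.1 hp).2)]
    refine Finset.sum_congr rfl fun k hk => ?_
    rw [qExpCoeff_smul_add_pow hq₀ hq₁ h]
    refine Finset.sum_congr ?_ fun _ _ => rfl
    ext p
    simp only [Finset.mem_filter, Finset.mem_product, Finset.mem_range,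
      Finset.HasAntidiagonal.mem_antidiagonal] at hk ⊢
    omega
  · intro p hp
    simp only [smul_mul_assoc, mul_smul_comm]
    rw [pow_mul_pow_eq_zero hJ hu hv (not_lt.1 (Finset.mem_filter.1 hp).2), smul_zero, smul_zero]

theorem qExpTrunc_smul (hJ : J ^ n = ⊥) {q : ℝ} (hq₀ : 0 < q) (hq₁ : q < 1) {x : R} (hx : x ∈ J) :
    qExpTrunc q n (q • x) = qExpTrunc q n x * (1 + x) := by
  -- The truncation error is a multiple of `x ^ m`, which vanishes for `m = n`.
  have key : ∀ m : ℕ, qExpTrunc q m (q • x) =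
      qExpTrunc q m x * (1 + x) + ((1 - q ^ m) * qExpCoeff q m) • x ^ m := by
    intro m
    induction m with
    | zero => simp [qExpTrunc]
    | succ m ih =>
      rw [qExpTrunc, qExpTrunc] at ih ⊢
      rw [Finset.sum_range_succ, Finset.sum_range_succ, ih, qExpCoeff_succ hq₀ hq₁, smul_pow,
        add_mul, smul_mul_assoc, mul_add (x ^ m), mul_one, ← pow_succ]
      module
  have h0 : x ^ n = 0 := by simpa using pow_mul_pow_eq_zero (j := 0) hJ hx hx (by omega : n ≤ n + 0)
  rw [key, h0, smul_zero, add_zero]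

/-- Moving `a` past `b ^ (k + 1)` costs `(1 - q ^ (k + 1)) • (b ^ k * h)`, and the coefficient
recursion turns these costs into `Ψ(b) * h`, up to a last term in `J ^ n`. -/
theorem mul_qExpTrunc (hJ : J ^ n = ⊥) {q : ℝ} (hq₀ : 0 < q) (hq₁ : q < 1) {a b h : R}
    (hb : b ∈ J) (hh : h ∈ J) (hab : a * b = b * a + (q - 1) • h) (hhb : h * b = q • (b * h)) :
    a * qExpTrunc q n b = qExpTrunc q n b * (a + h) := by
  have hpow : ∀ k : ℕ, a * b ^ (k + 1) = b ^ (k + 1) * a - (1 - q ^ (k + 1)) • (b ^ k * h) := by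
    intro k
    induction k with
    | zero =>
      simp only [zero_add, pow_one, pow_zero, one_mul, hab]
      module
    | succ k ih =>
      rw [pow_succ b (k + 1), ← mul_assoc, ih, sub_mul, smul_mul_assoc, mul_assoc _ a, hab,
        mul_assoc _ h, hhb, mul_add, mul_smul_comm, mul_smul_comm, ← mul_assoc, ← mul_assoc (b ^ k),
        ← pow_succ, ← pow_succ]
      module
  cases n with
  | zero => simp [qExpTrunc]
  | succ n =>
    have key : ∀ m : ℕ, a * qExpTrunc q (m + 1) b =
        qExpTrunc q (m + 1) b * (a + h) - qExpCoeff q m • (b ^ m * h) := by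
      intro m
      induction m with
      | zero => simp [qExpTrunc, qExpCoeff]
      | succ m ih =>
        rw [qExpTrunc] at ih ⊢
        rw [Finset.sum_range_succ _ (m + 1), mul_add, ih, add_mul, mul_smul_comm, hpow,
          smul_sub, smul_smul, mul_comm (qExpCoeff q (m + 1)), qExpCoeff_succ hq₀ hq₁,
          smul_mul_assoc, mul_add (b ^ (m + 1))]
        module
    have h0 := pow_mul_pow_eq_zero (i := n) (j := 1) hJ hb hh le_rfl
    rw [pow_one] at h0
    rw [key, h0, smul_zero, sub_zero]

/-- The pentagon identity. -/
theorem qExpTrunc_pentagon (hJ : J ^ n = ⊥) {q : ℝ} (hq₀ : 0 < q) (hq₁ : q < 1) {a b h : R}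
    (ha : a ∈ J) (hb : b ∈ J) (hh : h ∈ J) (hab : a * b = b * a + (q - 1) • h)
    (hhb : h * b = q • (b * h)) (hah : a * h = q • (h * a)) :
    qExpTrunc q n a * qExpTrunc q n b = qExpTrunc q n b * (qExpTrunc q n h * qExpTrunc q n a) := by
  -- `Ψ(h) Ψ(a)` merges into `Ψ(h + a)`, and `Ψ(b)` intertwines `a + h` with `a`.
  rw [← qExpTrunc_add hJ hq₀ hq₁ hh ha hah, add_comm h a]
  exact (SemiconjBy.qExpTrunc q n
    (show SemiconjBy _ (a + h) a from (mul_qExpTrunc hJ hq₀ hq₁ hb hh hab hhb).symm)).symm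

theorem mul_qExpTrunc_of_qcomm (hJ : J ^ n = ⊥) {q : ℝ} (hq₀ : 0 < q) (hq₁ : q < 1) {z a : R}
    (ha : a ∈ J) (h : z * a = q • (a * z)) :
    z * qExpTrunc q n a = qExpTrunc q n a * ((1 + a) * z) := by
  rw [← mul_assoc, ← qExpTrunc_smul hJ hq₀ hq₁ ha]
  exact SemiconjBy.qExpTrunc q n (show SemiconjBy z a (q • a) by rw [SemiconjBy, h, smul_mul_assoc])

theorem qExpTrunc_mul_of_qcomm (hJ : J ^ n = ⊥) {q : ℝ} (hq₀ : 0 < q) (hq₁ : q < 1) {z b : R}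
    (hb : b ∈ J) (h : b * z = q • (z * b)) :
    z * (1 + b) * qExpTrunc q n b = qExpTrunc q n b * z := by
  have hc : Commute (1 + b) (qExpTrunc q n b) :=
    Commute.qExpTrunc q n ((Commute.one_left b).add_left (Commute.refl b))
  rw [mul_assoc, hc.eq, ← qExpTrunc_smul hJ hq₀ hq₁ hb]
  exact SemiconjBy.qExpTrunc q n (show SemiconjBy z (q • b) b by rw [SemiconjBy, h, mul_smul_comm])

/-- After rewriting `Ψ(a) Ψ(b)` as `Ψ(b) Ψ(h) Ψ(a)`, the factor `1 + b` is absorbed in passing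
`Ψ(b)`, `z` commutes with `Ψ(h)`, and passing `Ψ(a)` creates `1 + a`. -/
theorem mul_qExpTrunc_mul_qExpTrunc (hJ : J ^ n = ⊥) {q : ℝ} (hq₀ : 0 < q) (hq₁ : q < 1)
    {a b h z : R} (ha : a ∈ J) (hb : b ∈ J) (hh : h ∈ J) (hab : a * b = b * a + (q - 1) • h)
    (hhb : h * b = q • (b * h)) (hah : a * h = q • (h * a)) (hza : z * a = q • (a * z))
    (hbz : b * z = q • (z * b)) (hzh : Commute z h) :
    z * (1 + b) * (qExpTrunc q n a * qExpTrunc q n b) =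
      qExpTrunc q n a * qExpTrunc q n b * ((1 + a) * z) := by
  rw [qExpTrunc_pentagon hJ hq₀ hq₁ ha hb hh hab hhb hah, ← mul_assoc,
    qExpTrunc_mul_of_qcomm hJ hq₀ hq₁ hb hbz, mul_assoc, ← mul_assoc z,
    (Commute.qExpTrunc q n hzh).eq, mul_assoc, mul_qExpTrunc_of_qcomm hJ hq₀ hq₁ ha hza]
  simp only [mul_assoc]

end Truncated

/-! ### Sums along diagonals and columns of the triangle -/

/-- The incidence matrix of the quiver, as a function of coordinates not confined to the triangle. -/
def gridForm (i j k l : ℕ) : ℤ :=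
  if (k = i ∧ l = j + 1) ∨ (k = i + 1 ∧ l = j) ∨ (i = k + 1 ∧ j = l + 1) then 1
  else if (i = k ∧ j = l + 1) ∨ (i = k + 1 ∧ j = l) ∨ (k = i + 1 ∧ l = j + 1) then -1 else 0

/-- A representation `z` of the quiver algebra by elements of a nilpotent ideal, continued by zero
outside the triangle. -/
structure IsGridRep {R : Type*} [Ring R] [Algebra ℝ R] (q : ℝ) (N n : ℕ) (J : Ideal R)
    (z : ℕ → ℕ → R) : Prop where
  q_pos : 0 < q
  q_lt_one : q < 1
  nilpotent : J ^ n = ⊥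
  mem : ∀ i j, z i j ∈ J
  eq_zero : ∀ i j, ¬ (1 ≤ i ∧ i < j ∧ j ≤ N) → z i j = 0
  mul_comm : ∀ i j k l, z i j * z k l = q ^ gridForm i j k l • (z k l * z i j)

/-- The product `z a b * z (a + 1) (b + 1) * ⋯` of `m` factors along a diagonal. -/
def diagChain {R : Type*} [Monoid R] (z : ℕ → ℕ → R) : ℕ → ℕ → ℕ → R
  | 0, _, _ => 1
  | m + 1, a, b => z a b * diagChain z m (a + 1) (b + 1)

/-- The product `⋯ * z (a + 1) b * z a b` of `m` factors along a column. -/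
def colChain {R : Type*} [Monoid R] (z : ℕ → ℕ → R) : ℕ → ℕ → ℕ → R
  | 0, _, _ => 1
  | m + 1, a, b => colChain z m (a + 1) b * z a b

/-- The sum of all chains along the diagonal starting at `(a, b)`. -/
def diagSum {R : Type*} [Semiring R] (z : ℕ → ℕ → R) (N a b : ℕ) : R :=
  ∑ t ∈ Finset.range (N + 1), diagChain z (t + 1) a b

/-- The sum of all chains along the column starting at `(a, b)`. -/
def colSum {R : Type*} [Semiring R] (z : ℕ → ℕ → R) (N a b : ℕ) : R :=
  ∑ t ∈ Finset.range (N + 1), colChain z (t + 1) a b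

theorem diagChain_succ {R : Type*} [Monoid R] (z : ℕ → ℕ → R) (m a b : ℕ) :
    diagChain z (m + 1) a b = z a b * diagChain z m (a + 1) (b + 1) := rfl

theorem diagChain_succ' {R : Type*} [Monoid R] (z : ℕ → ℕ → R) (m a b : ℕ) :
    diagChain z (m + 1) a b = diagChain z m a b * z (a + m) (b + m) := by
  induction m generalizing a b with
  | zero => simp [diagChain]
  | succ m ih =>
    rw [diagChain, ih, diagChain, mul_assoc]
    simp only [add_right_comm, add_assoc]

theorem mul_smul_mul_of_qcomm {R : Type*} [Ring R] [Algebra ℝ R] {q : ℝ} (hq : q ≠ 0)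
    {x y w : R} {k l : ℤ} (h₁ : x * w = q ^ k • (w * x)) (h₂ : y * w = q ^ l • (w * y)) :
    x * y * w = q ^ (k + l) • (w * (x * y)) := by
  rw [mul_assoc, h₂, mul_smul_comm, ← mul_assoc, h₁, smul_mul_assoc, smul_smul, zpow_add₀ hq,
    mul_comm (q ^ l), mul_assoc]

/-- The ordered product of the exponentials of the diagonal sums starting in a given row. -/
def rowProd {R : Type*} [Ring R] [Algebra ℝ R] (q : ℝ) (N n : ℕ)
    (z : ℕ → ℕ → R) (a m : ℕ) : R :=
  ((List.range m).map fun b => qExpTrunc q n (diagSum z N a b)).prod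

/-- The ordered product over `k` successive rows. -/
def rowsProd {R : Type*} [Ring R] [Algebra ℝ R] (q : ℝ) (N n : ℕ)
    (z : ℕ → ℕ → R) : ℕ → ℕ → R
  | 0, _ => 1
  -- The columns `0, …, N + 1 + a` are stable under `b ↦ N + 1 + a - b`; those off the triangle
  -- contribute trivial factors.
  | k + 1, a => rowProd q N n z a (N + 2 + a) * rowsProd q N n z k (a + 1)

namespace IsGridRep

variable {R : Type*} [Ring R] [Algebra ℝ R] {q : ℝ} {N n : ℕ} {J : Ideal R} {z : ℕ → ℕ → R}

theorem q_ne_zero (h : IsGridRep q N n J z) : q ≠ 0 := h.q_pos.ne'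

theorem commute (h : IsGridRep q N n J z) {i j k l : ℕ} (hf : gridForm i j k l = 0) :
    Commute (z i j) (z k l) := by
  have := h.mul_comm i j k l
  rwa [hf, zpow_zero, one_smul] at this

theorem qcomm (h : IsGridRep q N n J z) {i j k l : ℕ} (hf : gridForm i j k l = 1) :
    z i j * z k l = q • (z k l * z i j) := by
  have := h.mul_comm i j k l
  rwa [hf, zpow_one] at this

theorem diagChain_eq_zero (h : IsGridRep q N n J z) {m a b : ℕ} (hm : N < b + m) :
    diagChain z (m + 1) a b = 0 := by
  rw [diagChain_succ', h.eq_zero _ _ (by omega), mul_zero]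

theorem colChain_eq_zero (h : IsGridRep q N n J z) {m a b : ℕ} (hm : b ≤ a + m) :
    colChain z (m + 1) a b = 0 := by
  induction m generalizing a with
  | zero => rw [colChain, h.eq_zero _ _ (by omega), mul_zero]
  | succ m ih => rw [colChain, ih (by omega), zero_mul]

theorem diagSum_eq_zero (h : IsGridRep q N n J z) {a b : ℕ} (hb : ¬ (1 ≤ a ∧ a < b ∧ b ≤ N)) :
    diagSum z N a b = 0 :=
  Finset.sum_eq_zero fun t _ => by rw [diagChain, h.eq_zero a b hb, zero_mul]

theorem colSum_eq_zero (h : IsGridRep q N n J z) {a b : ℕ} (hb : ¬ (1 ≤ a ∧ a < b ∧ b ≤ N)) :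
    colSum z N a b = 0 :=
  Finset.sum_eq_zero fun t _ => by rw [colChain, h.eq_zero a b hb, mul_zero]

/-- Splitting off the first vertex; the one chain left over runs past column `N` and vanishes. This
recursion replaces explicit chains in what follows. -/
theorem diagSum_eq (h : IsGridRep q N n J z) (a b : ℕ) :
    diagSum z N a b = z a b * (1 + diagSum z N (a + 1) (b + 1)) := by
  rw [diagSum, Finset.sum_range_succ']
  have e : diagSum z N (a + 1) (b + 1) =
      ∑ t ∈ Finset.range N, diagChain z (t + 1) (a + 1) (b + 1) := by
    rw [diagSum, Finset.sum_range_succ, h.diagChain_eq_zero (by omega), add_zero]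
  rw [e, mul_add, mul_one, add_comm, Finset.mul_sum]
  simp [diagChain]

theorem colSum_eq (h : IsGridRep q N n J z) (a b : ℕ) :
    colSum z N a b = (1 + colSum z N (a + 1) b) * z a b := by
  by_cases hb : 1 ≤ a ∧ a < b ∧ b ≤ N
  · rw [colSum, Finset.sum_range_succ']
    have e : colSum z N (a + 1) b = ∑ t ∈ Finset.range N, colChain z (t + 1) (a + 1) b := by
      rw [colSum, Finset.sum_range_succ, h.colChain_eq_zero (by omega), add_zero]
    rw [e, add_mul, one_mul, add_comm, Finset.sum_mul]
    simp [colChain]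
  · rw [h.colSum_eq_zero hb, h.eq_zero a b hb, mul_zero]

theorem diagSum_mem [J.IsTwoSided] (h : IsGridRep q N n J z) (a b : ℕ) : diagSum z N a b ∈ J := by
  rw [h.diagSum_eq]
  exact Ideal.mul_mem_right _ _ (h.mem a b)

/-- Induction on the distance to the last column. -/
theorem diag_induction {P : ℕ → ℕ → Prop} (N : ℕ) (h0 : ∀ a b, N < b → P a b)
    (h1 : ∀ a b, P (a + 1) (b + 1) → P a b) (a b : ℕ) : P a b := by
  have : ∀ m a b, N < b + m → P a b := by
    intro m
    induction m with
    | zero => exact fun a b hb => h0 a b hb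
    | succ m ih => exact fun a b hb => h1 a b (ih _ _ (by omega))
  exact this (N + 1) a b (by omega)

/-! ### Commutation relations of diagonal sums -/

/-- Arrows only join vertices in equal or adjacent rows. -/
theorem commute_diagSum_of_lt (h : IsGridRep q N n J z) {i j : ℕ} (a b : ℕ) (ha : i + 2 ≤ a) :
    Commute (z i j) (diagSum z N a b) := by
  revert ha
  refine diag_induction (P := fun a b => i + 2 ≤ a → Commute (z i j) (diagSum z N a b)) N
    (fun a b hb _ => ?_) (fun a b ih ha => ?_) a b
  · rw [h.diagSum_eq_zero (by omega)]
    exact Commute.zero_right _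
  · rw [h.diagSum_eq]
    exact (h.commute (by unfold gridForm; split_ifs <;> omega)).mul_right
      ((Commute.one_right _).add_right (ih (by omega)))

theorem commute_diagSum_succ (h : IsGridRep q N n J z) {i j b : ℕ} (h₁ : b ≠ j) (h₂ : b ≠ j + 1) :
    Commute (z i j) (diagSum z N (i + 1) b) := by
  rw [h.diagSum_eq]
  exact (h.commute (by unfold gridForm; split_ifs <;> omega)).mul_right
    ((Commute.one_right _).add_right (h.commute_diagSum_of_lt _ _ (by omega)))

/-- Only the leading vertex of the chains is joined to `(i, j)`, so the whole sum inherits its power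
of `q`. -/
theorem diagSum_qcomm (h : IsGridRep q N n J z) (i j : ℕ) :
    diagSum z N (i + 1) (j + 1) * z i j = q • (z i j * diagSum z N (i + 1) (j + 1)) := by
  rw [h.diagSum_eq, mul_assoc, ((Commute.one_right _).add_right
    (h.commute_diagSum_of_lt _ _ (by omega))).symm.eq, ← mul_assoc,
    h.qcomm (by unfold gridForm; split_ifs <;> omega), smul_mul_assoc, mul_assoc]

theorem qcomm_diagSum (h : IsGridRep q N n J z) (i j : ℕ) :
    z i j * diagSum z N (i + 1) j = q • (diagSum z N (i + 1) j * z i j) := by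
  rw [h.diagSum_eq, mul_assoc _ _ (z i j), ((Commute.one_right _).add_right
    (h.commute_diagSum_of_lt _ _ (by omega))).symm.eq, ← mul_assoc,
    h.qcomm (by unfold gridForm; split_ifs <;> omega), smul_mul_assoc, mul_assoc]

theorem commute_diagSum_diagSum (h : IsGridRep q N n J z) (a b : ℕ) {d : ℕ} (hd : 2 ≤ d) :
    Commute (diagSum z N a b) (diagSum z N a (b + d)) := by
  refine diag_induction (P := fun a b => Commute (diagSum z N a b) (diagSum z N a (b + d))) N
    (fun a b hb => ?_) (fun a b ih => ?_) a b
  · rw [h.diagSum_eq_zero (by omega)]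
    exact Commute.zero_left _
  · have e : b + 1 + d = b + d + 1 := by omega
    rw [e] at ih
    have h₁ : Commute (z a b) (diagSum z N a (b + d)) := by
      rw [h.diagSum_eq a (b + d)]
      exact (h.commute (by unfold gridForm; split_ifs <;> omega)).mul_right
        ((Commute.one_right _).add_right (h.commute_diagSum_succ (by omega) (by omega)))
    have h₂ : Commute (diagSum z N (a + 1) (b + 1)) (diagSum z N a (b + d)) := by
      rw [h.diagSum_eq a (b + d)]
      exact (h.commute_diagSum_succ (by omega) (by omega)).symm.mul_right
        ((Commute.one_right _).add_right ih)
    rw [h.diagSum_eq a b]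
    exact h₁.mul_left ((Commute.one_left _).add_left h₂)

/-- The sum over pairs of chains on adjacent diagonals which enters the pentagon identity. -/
theorem exists_pentagon [J.IsTwoSided] (h : IsGridRep q N n J z) (a b : ℕ) :
    ∃ x ∈ J, diagSum z N a b * diagSum z N a (b + 1) =
        diagSum z N a (b + 1) * diagSum z N a b + (q - 1) • x ∧
      x * diagSum z N a (b + 1) = q • (diagSum z N a (b + 1) * x) ∧
      diagSum z N a b * x = q • (x * diagSum z N a b) := by
  refine diag_induction (P := fun a b => ∃ x ∈ J, diagSum z N a b * diagSum z N a (b + 1) =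
        diagSum z N a (b + 1) * diagSum z N a b + (q - 1) • x ∧
      x * diagSum z N a (b + 1) = q • (diagSum z N a (b + 1) * x) ∧
      diagSum z N a b * x = q • (x * diagSum z N a b)) N
    (fun a b hb => ⟨0, J.zero_mem, ?_⟩) (fun a b ih => ?_) a b
  · rw [h.diagSum_eq_zero (by omega)]
    simp
  · obtain ⟨x, hx, hAB, hxB, hAx⟩ := ih
    have hba := h.qcomm (i := a) (j := b) (k := a) (l := b + 1)
      (by unfold gridForm; split_ifs <;> omega)
    have hAa := h.diagSum_qcomm a b
    have hbA := h.qcomm_diagSum a (b + 1)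
    have hBb := h.diagSum_qcomm a (b + 1)
    have hBa : diagSum z N (a + 1) (b + 1 + 1) * z a b = z a b * diagSum z N (a + 1) (b + 1 + 1) :=
      (h.commute_diagSum_succ (i := a) (j := b) (by omega) (by omega)).symm
    have hq := h.q_ne_zero
    have hq1 : q - 1 ≠ 0 := (sub_neg.2 h.q_lt_one).ne
    rw [h.diagSum_eq a b, h.diagSum_eq a (b + 1)]
    have hbm := h.mem a (b + 1)
    generalize diagSum z N (a + 1) (b + 1) = A at *
    generalize diagSum z N (a + 1) (b + 1 + 1) = B at *
    generalize z a b = u at *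
    generalize z a (b + 1) = v at *
    have hAv : A * v = q⁻¹ • (v * A) := by rw [hbA, smul_smul, inv_mul_cancel₀ hq, one_smul]
    -- As `q ≠ 1`, `x` is a multiple of the commutator of `A` and `B`, so its relations with `u` and
    -- `v` follow from theirs.
    have hx' : x = (q - 1)⁻¹ • (A * B - B * A) := by
      rw [hAB, add_sub_cancel_left, smul_smul, inv_mul_cancel₀ hq1, one_smul]
    have hxu : x * u = q • (u * x) := by
      rw [hx', smul_mul_assoc, sub_mul, mul_assoc, mul_assoc, hBa, hAa, ← mul_assoc, hAa,
        mul_smul_comm, ← mul_assoc B, hBa, mul_smul_comm, mul_sub, smul_mul_assoc,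
        mul_assoc, mul_assoc]
      module
    have hxv : x * v = v * x := by
      rw [hx', smul_mul_assoc, sub_mul, mul_assoc, mul_assoc, hBb, hAv, mul_smul_comm,
        mul_smul_comm, ← mul_assoc, ← mul_assoc, hBb, hAv]
      simp only [smul_mul_assoc, mul_smul_comm, smul_smul, mul_inv_cancel₀ hq, inv_mul_cancel₀ hq,
        one_smul, mul_assoc, mul_sub]
    have assoc {x y w : R} (e : x * y = w) (t : R) : x * (y * t) = w * t := by rw [← mul_assoc, e]
    -- Expanding the commutator of `u * (1 + A)` and `v * (1 + B)` and moving `v * u` to the left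
    -- leaves `(q - 1) • (v * u * (1 + B + x))`.
    refine ⟨v * u * (1 + B + x), Ideal.mul_mem_right _ _ (Ideal.mul_mem_right _ _ hbm), ?_, ?_, ?_⟩
    all_goals
      simp only [mul_add, add_mul, mul_one, mul_assoc, smul_mul_assoc, mul_smul_comm,
        smul_add, smul_smul, hba, assoc hba, hAa, assoc hAa, hAv, assoc hAv, hBb, assoc hBb,
        hBa, assoc hBa, hxu, assoc hxu, hxv, assoc hxv, hAB, hxB, hAx]
      match_scalars <;> field_simp <;> ring

/-! ### Conjugation by products of rows -/

variable [J.IsTwoSided]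

theorem rowProd_succ (a m : ℕ) : rowProd q N n z a (m + 1) =
    rowProd q N n z a m * qExpTrunc q n (diagSum z N a m) := by
  simp [rowProd, List.range_succ]

theorem rowProd_commute {t : R} {a m : ℕ} (ht : ∀ b < m, Commute t (diagSum z N a b)) :
    Commute t (rowProd q N n z a m) := by
  refine Commute.list_prod_right _ _ fun x hx => ?_
  obtain ⟨b, hb, rfl⟩ := List.mem_map.1 hx
  exact Commute.qExpTrunc q n (ht b (List.mem_range.1 hb))

omit [J.IsTwoSided] in
theorem commute_rowsProd (h : IsGridRep q N n J z) {i j k a : ℕ} (ha : i + 2 ≤ a) :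
    Commute (z i j) (rowsProd q N n z k a) := by
  induction k generalizing a with
  | zero => exact Commute.one_right _
  | succ k ih =>
    exact (rowProd_commute fun b _ => h.commute_diagSum_of_lt a b ha).mul_right (ih (by omega))

/-- The exchange of a diagonal step for a vertical one. Factors before column `j` commute with the
left-hand prefix, those after column `j + 1` with the right-hand suffix, and the two in between are
handled by the pentagon. -/
theorem mul_rowProd (h : IsGridRep q N n J z) {i j m : ℕ} :
    z i j * (1 + diagSum z N (i + 1) (j + 1)) * rowProd q N n z (i + 1) (j + 2 + m) =
      rowProd q N n z (i + 1) (j + 2 + m) * ((1 + diagSum z N (i + 1) j) * z i j) := by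
  induction m with
  | zero =>
    obtain ⟨x, hx, hAB, hxB, hAx⟩ := h.exists_pentagon (i + 1) j
    have hc : Commute (z i j * (1 + diagSum z N (i + 1) (j + 1))) (rowProd q N n z (i + 1) j) := by
      refine rowProd_commute fun b hb => (h.commute_diagSum_succ (by omega) (by omega)).mul_left
        ((Commute.one_left _).add_left ?_)
      obtain ⟨d, hd⟩ := Nat.exists_eq_add_of_le hb.le
      rw [hd, add_assoc]
      exact (h.commute_diagSum_diagSum _ _ (by omega)).symm
    have hza := h.qcomm_diagSum i j
    have hbz := h.diagSum_qcomm i j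
    -- The powers `q` and `q⁻¹` picked up from the two diagonal sums cancel in both of their
    -- products, hence in `x`.
    have hzx : Commute (z i j) x := by
      have hq1 : q - 1 ≠ 0 := (sub_neg.2 h.q_lt_one).ne
      have hx' : x = (q - 1)⁻¹ • (diagSum z N (i + 1) j * diagSum z N (i + 1) (j + 1) -
          diagSum z N (i + 1) (j + 1) * diagSum z N (i + 1) j) := by
        rw [hAB, add_sub_cancel_left, smul_smul, inv_mul_cancel₀ hq1, one_smul]
      rw [hx']
      refine Commute.smul_right (Commute.sub_right ?_ ?_) _
      · rw [Commute, SemiconjBy, ← mul_assoc, hza, smul_mul_assoc, mul_assoc, mul_assoc, hbz,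
          mul_smul_comm]
      · rw [Commute, SemiconjBy, mul_assoc _ _ (z i j), ← smul_right_injective R h.q_ne_zero |>.eq_iff]
        rw [← mul_assoc, ← smul_mul_assoc, ← hbz, mul_assoc, hza, mul_smul_comm]
    rw [add_zero, rowProd_succ, rowProd_succ, mul_assoc (rowProd q N n z (i + 1) j), ← mul_assoc,
      hc.eq, mul_assoc, mul_qExpTrunc_mul_qExpTrunc h.nilpotent h.q_pos h.q_lt_one
        (h.diagSum_mem _ _) (h.diagSum_mem _ _) hx hAB hxB hAx hza hbz hzx, ← mul_assoc]
  | succ m ih =>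
    have hc : Commute ((1 + diagSum z N (i + 1) j) * z i j)
        (qExpTrunc q n (diagSum z N (i + 1) (j + 2 + m))) := by
      refine Commute.qExpTrunc q n (((Commute.one_left _).add_left ?_).mul_left
        (h.commute_diagSum_succ (by omega) (by omega)))
      rw [add_assoc]
      exact h.commute_diagSum_diagSum _ _ (by omega)
    rw [← add_assoc, rowProd_succ, ← mul_assoc, ih, mul_assoc, hc.eq, mul_assoc]

/-- Conjugation by the product over the rows below turns diagonal sums into column sums. -/
theorem diagSum_mul_rowsProd (h : IsGridRep q N n J z) {a j k : ℕ} (hk : N ≤ a + k + 1) :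
    diagSum z N a j * rowsProd q N n z k (a + 1) =
      rowsProd q N n z k (a + 1) * colSum z N a j := by
  induction k generalizing a j with
  | zero =>
    -- Row `a + 1` is empty here, so both sums reduce to `z a j`.
    rw [h.diagSum_eq, h.colSum_eq, h.diagSum_eq_zero (by omega), h.colSum_eq_zero (by omega)]
    simp [rowsProd]
  | succ k ih =>
    by_cases hj : 1 ≤ a ∧ a < j ∧ j ≤ N
    · obtain ⟨m, hm⟩ := Nat.exists_eq_add_of_le (show j + 2 ≤ N + 2 + (a + 1) by omega)
      -- After crossing row `a + 1`, `z a j` commutes with the remaining rows, at distance at least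
      -- two, and the new diagonal sum is treated by induction.
      rw [h.diagSum_eq, h.colSum_eq, rowsProd, hm, ← mul_assoc, h.mul_rowProd, mul_assoc,
        mul_assoc _ (z a j), (h.commute_rowsProd (by omega)).eq, ← mul_assoc (1 + _), add_mul,
        ih (by omega), one_mul]
      noncomm_ring
    · rw [h.diagSum_eq_zero hj, h.colSum_eq_zero hj, zero_mul, mul_zero]

theorem rowsProd_succ_eq (h : IsGridRep q N n J z) {a k : ℕ} (hk : N ≤ a + k + 1) :
    rowsProd q N n z (k + 1) a = rowsProd q N n z k (a + 1) *
      ((List.range (N + 2 + a)).map fun b => qExpTrunc q n (colSum z N a b)).prod := by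
  rw [rowsProd, rowProd]
  induction List.range (N + 2 + a) with
  | nil => simp
  | cons b l ih =>
    rw [List.map_cons, List.map_cons, List.prod_cons, List.prod_cons, mul_assoc, ih, ← mul_assoc,
      ← mul_assoc, (SemiconjBy.qExpTrunc q n (show SemiconjBy _ (colSum z N a b) (diagSum z N a b)
        from (h.diagSum_mul_rowsProd hk).symm)).eq]

end IsGridRep

/-! ### Reordering of products -/

/-- Bubble sort: moving the head of `l₁` to the front of `l₂` crosses only entries ordered
oppositely in the two lists. -/
theorem prod_map_eq_of_pairwise {ι M : Type*} [Monoid M] (f : ι → M) {r₁ r₂ : ι → ι → Prop}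
    {l₁ l₂ : List ι} (hp : l₁.Perm l₂) (h₁ : l₁.Pairwise r₁) (h₂ : l₂.Pairwise r₂)
    (hc : ∀ x ∈ l₁, ∀ y ∈ l₁, r₁ x y → r₂ y x → Commute (f x) (f y)) :
    (l₁.map f).prod = (l₂.map f).prod := by
  induction l₁ generalizing l₂ with
  | nil => rw [List.nil_perm.1 hp]
  | cons x l ih =>
    obtain ⟨u, v, rfl⟩ := List.append_of_mem (hp.mem_iff.1 List.mem_cons_self)
    have hp' : l.Perm (u ++ v) := (List.perm_cons x).1 (hp.trans List.perm_middle)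
    rw [List.pairwise_cons] at h₁
    have h₂' : (u ++ v).Pairwise r₂ := h₂.sublist (by simp)
    have hux : Commute (f x) (u.map f).prod := by
      refine Commute.list_prod_right _ _ fun w hw => ?_
      obtain ⟨y, hy, rfl⟩ := List.mem_map.1 hw
      have hyl : y ∈ l := hp'.mem_iff.2 (List.mem_append_left _ hy)
      exact hc x List.mem_cons_self y (List.mem_cons_of_mem _ hyl) (h₁.1 y hyl)
        ((List.pairwise_append.1 h₂).2.2 y hy x List.mem_cons_self)
    have := ih hp' h₁.2 h₂' fun y hy w hw => hc y (List.mem_cons_of_mem _ hy) w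
      (List.mem_cons_of_mem _ hw)
    rw [List.map_cons, List.prod_cons, this]
    simp only [List.map_append, List.prod_append, List.map_cons, List.prod_cons]
    rw [← mul_assoc, hux.eq, mul_assoc]

theorem prod_map_filter {ι M : Type*} [Monoid M] (f : ι → M) (P : ι → Prop) [DecidablePred P]
    (l : List ι) (h : ∀ x ∈ l, ¬ P x → f x = 1) :
    ((l.filter P).map f).prod = (l.map f).prod := by
  induction l with
  | nil => rfl
  | cons x l ih =>
    have ih' := ih fun y hy => h y (List.mem_cons_of_mem _ hy)
    by_cases hx : P x
    · simp [hx, ih']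
    · simp [hx, ih', h x List.mem_cons_self hx]

theorem sort_eq_of_pairwise {ι : Type*} [LinearOrder ι] {s : Finset ι} {l : List ι}
    (hl : l.Pairwise (· < ·)) (hs : ∀ x, x ∈ l ↔ x ∈ s) : s.sort = l := by
  have : l.toFinset = s := by ext x; simp [hs]
  rw [← this]
  exact (List.toFinset_sort _ (hl.imp ne_of_lt)).2 (hl.imp le_of_lt)

theorem orderedProd_eq {ι M : Type*} [LinearOrder ι] [Monoid M] (s : Finset ι) (F : ι → M) :
    orderedProd s (fun x => F x.1) = (s.sort.map F).prod := by
  have : s.sort = s.attach.sort.map Subtype.val := by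
    refine sort_eq_of_pairwise ?_ fun x => by simp
    rw [List.pairwise_map]
    exact s.attach.sortedLT_sort.pairwise
  rw [this, List.map_map]
  rfl

/-! ### Chains and the product over the tetrahedron -/

/-- The exponential of the chain attached to a point of the tetrahedron. -/
def chainExp {R : Type*} [Ring R] [Algebra ℝ R] (q : ℝ) (n : ℕ) (z : ℕ → ℕ → R)
    (p : ℕ ×ₗ ℕ ×ₗ ℕ) : R :=
  qExpTrunc q n (diagChain z ((ofLex (ofLex p).2).2 - (ofLex (ofLex p).2).1) (ofLex p).1
    (ofLex (ofLex p).2).1)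

/-- The lexicographically ordered product of `chainExp` over the tetrahedron. -/
def tetraProd {R : Type*} [Ring R] [Algebra ℝ R] (q : ℝ) (N n : ℕ) (z : ℕ → ℕ → R) : R :=
  ((tetrahedron N).sort.map (chainExp q n z)).prod

open MulOpposite

theorem unop_map_qExpTrunc {R S : Type*} [Ring R] [Algebra ℝ R] [Ring S] [Algebra ℝ S]
    (F : R →ₐ[ℝ] Sᵐᵒᵖ) (q : ℝ) (n : ℕ) (x : R) :
    unop (F (qExpTrunc q n x)) = qExpTrunc q n (unop (F x)) := by
  simp [qExpTrunc, map_sum, Finset.unop_sum]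

theorem unop_map_prod {ι R S : Type*} [Ring R] [Algebra ℝ R] [Ring S] [Algebra ℝ S]
    (F : R →ₐ[ℝ] Sᵐᵒᵖ) (l : List ι) (f : ι → R) :
    unop (F (l.map f).prod) = (l.reverse.map fun x => unop (F (f x))).prod := by
  induction l with
  | nil => simp
  | cons x l ih => simp [ih]

theorem reverse_map_range {α : Type*} (m : ℕ) (g : ℕ → α) :
    (List.range m).reverse.map (fun b => g (m - 1 - b)) = (List.range m).map g := by
  refine List.ext_getElem (by simp) fun i h₁ h₂ => ?_
  simp only [List.length_map, List.length_range] at h₂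
  simp only [List.getElem_map, List.getElem_reverse, List.getElem_range, List.length_range]
  congr 1
  omega

theorem rowsProd_eq {R : Type*} [Ring R] [Algebra ℝ R] (q : ℝ) (N n : ℕ) (z : ℕ → ℕ → R)
    (k a : ℕ) : rowsProd q N n z k a =
      ((List.range' a k).map fun a => rowProd q N n z a (N + 2 + a)).prod := by
  induction k generalizing a with
  | zero => rfl
  | succ k ih => rw [rowsProd, ih, List.range'_succ, List.map_cons, List.prod_cons]

/-- Points of a box containing the tetrahedron, in lexicographic order. -/
def boxList (N : ℕ) : List (ℕ ×ₗ ℕ ×ₗ ℕ) :=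
  (List.range (N + 1)).flatMap fun a => (List.range (N + 2 + a)).flatMap fun b =>
    (List.range (N + 1)).map fun t => toLex (a, toLex (b, b + 1 + t))

theorem boxList_pairwise (N : ℕ) : (boxList N).Pairwise (· < ·) := by
  rw [boxList, List.pairwise_flatMap]
  refine ⟨fun a _ => List.pairwise_flatMap.2 ⟨fun b _ => ?_, ?_⟩, ?_⟩
  · rw [List.pairwise_map]
    refine List.pairwise_lt_range.imp fun h => ?_
    simp only [Prod.Lex.toLex_lt_toLex, true_and]
    omega
  · refine List.pairwise_lt_range.imp fun h => ?_
    simp only [List.mem_map]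
    rintro _ ⟨s, _, rfl⟩ _ ⟨t, _, rfl⟩
    simp only [Prod.Lex.toLex_lt_toLex, true_and]
    omega
  · refine List.pairwise_lt_range.imp fun h => ?_
    simp only [List.mem_map, List.mem_flatMap]
    rintro _ ⟨_, _, s, _, rfl⟩ _ ⟨_, _, t, _, rfl⟩
    simp only [Prod.Lex.toLex_lt_toLex]
    omega

theorem sort_tetrahedron (N : ℕ) :
    (tetrahedron N).sort = (boxList N).filter (· ∈ tetrahedron N) := by
  refine sort_eq_of_pairwise ((boxList_pairwise N).filter _) fun x => ?_
  obtain ⟨a, b, c, rfl⟩ : ∃ a b c, x = toLex (a, toLex (b, c)) := ⟨_, _, _, rfl⟩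
  simp only [List.mem_filter, decide_eq_true_eq, and_iff_right_iff_imp, mem_tetrahedron, boxList,
    List.mem_flatMap, List.mem_map, List.mem_range]
  intro h
  exact ⟨a, by omega, b, by omega, c - b - 1, by omega, by
    rw [show b + 1 + (c - b - 1) = c by omega]⟩

/-- `(a, b, c) ↦ (N + 2 - c, N + 2 + b - a - c, N + 2 - a)` -/
def tetraRefl (N : ℕ) (p : ℕ ×ₗ ℕ ×ₗ ℕ) : ℕ ×ₗ ℕ ×ₗ ℕ :=
  toLex (N + 2 - (ofLex (ofLex p).2).2, toLex
    (N + 2 + (ofLex (ofLex p).2).1 - (ofLex p).1 - (ofLex (ofLex p).2).2, N + 2 - (ofLex p).1))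

theorem tetraRefl_mem {N : ℕ} {p : ℕ ×ₗ ℕ ×ₗ ℕ} (hp : p ∈ tetrahedron N) :
    tetraRefl N p ∈ tetrahedron N := by
  obtain ⟨a, b, c, rfl⟩ : ∃ a b c, p = toLex (a, toLex (b, c)) := ⟨_, _, _, rfl⟩
  rw [mem_tetrahedron] at hp
  simp only [tetraRefl, mem_tetrahedron, ofLex_toLex]
  omega

theorem tetraRefl_tetraRefl {N : ℕ} {p : ℕ ×ₗ ℕ ×ₗ ℕ} (hp : p ∈ tetrahedron N) :
    tetraRefl N (tetraRefl N p) = p := by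
  obtain ⟨a, b, c, rfl⟩ : ∃ a b c, p = toLex (a, toLex (b, c)) := ⟨_, _, _, rfl⟩
  rw [mem_tetrahedron] at hp
  simp only [tetraRefl, ofLex_toLex, EmbeddingLike.apply_eq_iff_eq, Prod.mk.injEq]
  omega

namespace IsGridRep

variable {R : Type*} [Ring R] [Algebra ℝ R] {q : ℝ} {N n : ℕ} {J : Ideal R} {z : ℕ → ℕ → R}

theorem diagChain_mul (h : IsGridRep q N n J z) (m a b i j : ℕ) :
    diagChain z m a b * z i j =
      q ^ (∑ t ∈ Finset.range m, gridForm (a + t) (b + t) i j) • (z i j * diagChain z m a b) := by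
  induction m with
  | zero => simp [diagChain]
  | succ m ih =>
    rw [diagChain_succ', Finset.sum_range_succ]
    exact mul_smul_mul_of_qcomm h.q_ne_zero ih (h.mul_comm _ _ _ _)

theorem commute_diagChain_of_sum (h : IsGridRep q N n J z) {m a b m' a' b' : ℕ}
    (hs : ∀ r < m', ∑ t ∈ Finset.range m, gridForm (a + t) (b + t) (a' + r) (b' + r) = 0) :
    Commute (diagChain z m a b) (diagChain z m' a' b') := by
  induction m' with
  | zero => exact Commute.one_right _
  | succ m' ih =>
    rw [diagChain_succ']
    refine (ih fun r hr => hs r (by omega)).mul_right ?_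
    have := h.diagChain_mul m a b (a' + m') (b' + m')
    rwa [hs m' (by omega), zpow_zero, one_smul] at this

theorem diagChain_mul_pred (h : IsGridRep q N n J z) (m a b : ℕ) :
    diagChain z (m + 1) (a + 1) (b + 1) * z a b =
      q • (z a b * diagChain z (m + 1) (a + 1) (b + 1)) := by
  rw [h.diagChain_mul, Finset.sum_eq_single 0]
  · simp [gridForm]
  · intro r _ hr
    unfold gridForm
    split_ifs <;> omega
  · simp

/-- Each of the `t + 1` vertices of the shorter chain has its successor in the longer one, and all
but the first have their predecessor there: the net exponent is `(t + 1) - t = 1`. -/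
theorem diagChain_mul_diagChain (h : IsGridRep q N n J z) {t m : ℕ} (ht : t < m) (a b : ℕ) :
    diagChain z (m + 1) a b * diagChain z (t + 1) a b =
      q • (diagChain z (t + 1) a b * diagChain z (m + 1) a b) := by
  obtain ⟨m, rfl⟩ := Nat.exists_eq_succ_of_ne_zero (show m ≠ 0 by omega)
  induction t generalizing m a b with
  | zero =>
    have key := h.diagChain_mul_pred m a b
    simp only [diagChain, mul_one] at key ⊢
    rw [mul_assoc, key, mul_smul_comm]
  | succ t ih =>
    obtain ⟨m, rfl⟩ := Nat.exists_eq_succ_of_ne_zero (show m ≠ 0 by omega)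
    have ih' := ih (a + 1) (b + 1) m (by omega)
    have k₁ := h.diagChain_mul_pred (m + 1) a b
    have k₂ := h.diagChain_mul_pred t a b
    rw [diagChain_succ z m.succ.succ, diagChain_succ z (t + 1)]
    simp only [Nat.succ_eq_add_one] at ih' ⊢
    generalize diagChain z (m + 1 + 1) (a + 1) (b + 1) = x at *
    generalize diagChain z (t + 1) (a + 1) (b + 1) = y at *
    rw [mul_assoc, ← mul_assoc x, k₁, mul_assoc (z a b) y, ← mul_assoc y, k₂, smul_mul_assoc,
      smul_mul_assoc, mul_assoc _ x, ih', mul_assoc _ y]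
    simp only [mul_smul_comm]

/-- The hypotheses say that the two points are in increasing lexicographic order both before and
after `tetraRefl`, the case needed for the second reflection. -/
theorem commute_diagChain (h : IsGridRep q N n J z) {a b c a' b' c' : ℕ} (hbc : b < c) (hbc' : b' < c')
    (h₁ : a < a' ∨ a = a' ∧ (b < b' ∨ b = b' ∧ c < c'))
    (h₂ : c' < c ∨ c' = c ∧ (b + a' < b' + a ∨ b + a' = b' + a ∧ a' < a)) :
    Commute (diagChain z (c - b) a b) (diagChain z (c' - b') a' b') := by
  refine h.commute_diagChain_of_sum fun r hr => ?_
  -- `p` and `p'` are the positions in the first chain contributing `+1` and `-1`; the order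
  -- hypotheses keep both inside the chain. For diagonals further apart nothing contributes, and `p
  -- = p' = 0` serves.
  obtain ⟨p, p', hp, hp', hf⟩ : ∃ p p', p < c - b ∧ p' < c - b ∧ ∀ t,
      gridForm (a + t) (b + t) (a' + r) (b' + r) =
        (if t = p then 1 else 0) - (if t = p' then 1 else 0) := by
    unfold gridForm
    rcases (by omega : b + a' = b' + a ∨ b' + a = b + a' + 1 ∨ b' + a + 1 = b + a' ∨
      b' + a + 1 < b + a' ∨ b + a' + 1 < b' + a) with hd | hd | hd | hd | hd
    · refine ⟨a' + r - a + 1, a' + r - a - 1, by omega, by omega, fun t => ?_⟩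
      split_ifs <;> omega
    · refine ⟨a' + r - a, a' + r - a + 1, by omega, by omega, fun t => ?_⟩
      split_ifs <;> omega
    · refine ⟨a' + r - a - 1, a' + r - a, by omega, by omega, fun t => ?_⟩
      split_ifs <;> omega
    all_goals
      refine ⟨0, 0, by omega, by omega, fun t => ?_⟩
      split_ifs <;> omega
  rw [Finset.sum_congr rfl fun t _ => hf t, Finset.sum_sub_distrib, Finset.sum_ite_eq',
    Finset.sum_ite_eq', if_pos (Finset.mem_range.2 hp), if_pos (Finset.mem_range.2 hp'), sub_self]

variable [J.IsTwoSided]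

theorem diagChain_mem (h : IsGridRep q N n J z) (m a b : ℕ) : diagChain z (m + 1) a b ∈ J :=
  Ideal.mul_mem_right _ _ (h.mem a b)

theorem prod_qExpTrunc_diagChain (h : IsGridRep q N n J z) (a b m : ℕ) :
    ((List.range m).map fun t => qExpTrunc q n (diagChain z (t + 1) a b)).prod =
      qExpTrunc q n (∑ t ∈ Finset.range m, diagChain z (t + 1) a b) := by
  induction m with
  | zero => simp [qExpTrunc_zero h.nilpotent]
  | succ m ih =>
    rw [List.range_succ, List.map_append, List.prod_append, ih, Finset.sum_range_succ,
      qExpTrunc_add h.nilpotent h.q_pos h.q_lt_one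
        (J.sum_mem fun t _ => h.diagChain_mem t a b) (h.diagChain_mem m a b)]
    · simp
    · rw [Finset.mul_sum, Finset.sum_mul, Finset.smul_sum]
      exact Finset.sum_congr rfl fun t ht =>
        h.diagChain_mul_diagChain (Finset.mem_range.1 ht) a b

/-- The factors over `c` collapse by the addition formula. Points of the box outside the tetrahedron
carry zero chains, hence factors `1`. -/
theorem tetraProd_eq (h : IsGridRep q N n J z) :
    tetraProd q N n z = rowsProd q N n z (N + 1) 0 := by
  rw [tetraProd, sort_tetrahedron, prod_map_filter, boxList, rowsProd_eq, List.range_eq_range']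
  · simp only [List.flatMap, List.map_flatten, List.prod_flatten, List.map_map]
    refine congrArg List.prod (List.map_congr_left fun a _ => ?_)
    simp only [Function.comp_apply, List.map_flatten, List.prod_flatten, List.map_map, rowProd]
    refine congrArg List.prod (List.map_congr_left fun b _ => ?_)
    rw [diagSum, ← h.prod_qExpTrunc_diagChain, ← List.range_eq_range']
    simp only [Function.comp_apply, List.map_map]
    refine congrArg List.prod (List.map_congr_left fun t _ => ?_)
    simp only [Function.comp_apply, chainExp, ofLex_toLex]
    rw [show b + 1 + t - b = t + 1 by omega]
  · intro p hp hpN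
    simp only [boxList, List.mem_flatMap, List.mem_map, List.mem_range] at hp
    obtain ⟨a, _, b, _, t, _, rfl⟩ := hp
    rw [mem_tetrahedron] at hpN
    rw [chainExp]
    simp only [ofLex_toLex]
    rw [show b + 1 + t - b = t + 1 by omega]
    convert qExpTrunc_zero h.nilpotent q
    by_cases hb : 1 ≤ a ∧ a < b ∧ b ≤ N
    · exact h.diagChain_eq_zero (by omega)
    · rw [diagChain, h.eq_zero a b hb, zero_mul]

/-! ### Invariance under the two reflections -/

omit [J.IsTwoSided] in
-- The reflection carries diagonals to columns, and reversing products turns the recursion for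
-- diagonal sums into the one for column sums.
theorem unop_map_diagSum (h : IsGridRep q N n J z) (F : R →ₐ[ℝ] Rᵐᵒᵖ)
    (hF : ∀ i j, F (z i j) = op (z i (N + 1 + i - j))) (a b : ℕ) :
    unop (F (diagSum z N a b)) = colSum z N a (N + 1 + a - b) := by
  refine diag_induction (P := fun a b => unop (F (diagSum z N a b)) =
    colSum z N a (N + 1 + a - b)) N (fun a b hb => ?_) (fun a b ih => ?_) a b
  · rw [h.diagSum_eq_zero (by omega), h.colSum_eq_zero (by omega), map_zero, unop_zero]
  · rw [h.diagSum_eq, h.colSum_eq, map_mul, unop_mul, map_add, map_one, unop_add, unop_one, ih,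
      hF, unop_op, show N + 1 + (a + 1) - (b + 1) = N + 1 + a - b by omega]

/-- Invariance under the reversal of the rows. -/
theorem unop_map_tetraProd_of_row (h : IsGridRep q N n J z) (F : R →ₐ[ℝ] Rᵐᵒᵖ)
    (hF : ∀ i j, F (z i j) = op (z i (N + 1 + i - j))) :
    unop (F (tetraProd q N n z)) = tetraProd q N n z := by
  have key : ∀ k a, N ≤ a + k → unop (F (rowsProd q N n z k a)) = rowsProd q N n z k a := by
    intro k
    induction k with
    | zero => intro a _; simp [rowsProd]
    | succ k ih =>
      intro a ha
      -- With row `a` moved to the right end, the right side matches the image factor by factor,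
      -- after `b ↦ N + 1 + a - b`.
      conv_rhs => rw [h.rowsProd_succ_eq (by omega)]
      rw [rowsProd, map_mul, unop_mul, ih _ (by omega), rowProd,
        unop_map_prod, ← reverse_map_range]
      simp only [unop_map_qExpTrunc, h.unop_map_diagSum F hF]
      rw [show N + 2 + a - 1 = N + 1 + a by omega]
  rw [h.tetraProd_eq]
  exact key _ _ (by omega)

omit [J.IsTwoSided] in
-- The image starts at the reflection of the last vertex; the bounds keep the natural subtractions
-- exact.
theorem unop_map_diagChain (F : R →ₐ[ℝ] Rᵐᵒᵖ)
    (hF : ∀ i j, F (z i j) = op (z (N + 1 - j) (N + 1 - i))) {m a b : ℕ} (ha : a + m ≤ N + 1)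
    (hb : b + m ≤ N + 1) :
    unop (F (diagChain z m a b)) = diagChain z m (N + 2 - b - m) (N + 2 - a - m) := by
  induction m generalizing a b with
  | zero => simp [diagChain]
  | succ m ih =>
    rw [diagChain, map_mul, unop_mul, ih (by omega) (by omega), hF, unop_op, diagChain_succ']
    congr 2 <;> omega

omit [J.IsTwoSided] in
/-- Invariance under the reversal of the diagonals. -/
theorem unop_map_tetraProd_of_diag (h : IsGridRep q N n J z) (F : R →ₐ[ℝ] Rᵐᵒᵖ)
    (hF : ∀ i j, F (z i j) = op (z (N + 1 - j) (N + 1 - i))) :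
    unop (F (tetraProd q N n z)) = tetraProd q N n z := by
  have hmem : ∀ p ∈ (tetrahedron N).sort, p ∈ tetrahedron N := fun p => (Finset.mem_sort _).1
  have e : unop (F (tetraProd q N n z)) =
      (((tetrahedron N).sort.reverse.map (tetraRefl N)).map (chainExp q n z)).prod := by
    rw [tetraProd, unop_map_prod, List.map_map]
    refine congrArg List.prod (List.map_congr_left fun p hp => ?_)
    have hp := hmem p (List.mem_reverse.1 hp)
    obtain ⟨a, b, c, rfl⟩ : ∃ a b c, p = toLex (a, toLex (b, c)) := ⟨_, _, _, rfl⟩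
    rw [mem_tetrahedron] at hp
    simp only [Function.comp_apply, chainExp, tetraRefl, ofLex_toLex, unop_map_qExpTrunc]
    rw [unop_map_diagChain F hF (by omega) (by omega)]
    congr 2 <;> omega
  rw [e, tetraProd]
  symm
  refine prod_map_eq_of_pairwise (r₁ := (· < ·))
    (r₂ := fun x y => tetraRefl N y < tetraRefl N x) _ ?_ (Finset.sortedLT_sort _).pairwise ?_ ?_
  · have hinj : ∀ x ∈ (tetrahedron N).sort.reverse, ∀ y ∈ (tetrahedron N).sort.reverse,
        tetraRefl N x = tetraRefl N y → x = y := fun x hx y hy hxy => by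
      rw [← tetraRefl_tetraRefl (hmem x (List.mem_reverse.1 hx)), hxy,
        tetraRefl_tetraRefl (hmem y (List.mem_reverse.1 hy))]
    refine (List.perm_ext_iff_of_nodup (Finset.sort_nodup _ _)
      ((List.nodup_reverse.2 (Finset.sort_nodup _ _)).map_on hinj)).2 fun p => ?_
    simp only [List.mem_map, List.mem_reverse, Finset.mem_sort]
    exact ⟨fun hp => ⟨_, tetraRefl_mem hp, tetraRefl_tetraRefl hp⟩,
      fun ⟨x, hx, hxp⟩ => hxp ▸ tetraRefl_mem hx⟩
  · rw [List.pairwise_map, List.pairwise_reverse]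
    refine (Finset.sortedLT_sort _).pairwise.imp_of_mem fun hx hy hxy => ?_
    rwa [tetraRefl_tetraRefl (hmem _ hx), tetraRefl_tetraRefl (hmem _ hy)]
  · intro x hx y hy hxy hyx
    have hx := hmem x hx
    have hy := hmem y hy
    obtain ⟨a, b, c, rfl⟩ : ∃ a b c, x = toLex (a, toLex (b, c)) := ⟨_, _, _, rfl⟩
    obtain ⟨a', b', c', rfl⟩ : ∃ a b c, y = toLex (a, toLex (b, c)) := ⟨_, _, _, rfl⟩
    rw [mem_tetrahedron] at hx hy
    simp only [tetraRefl, Prod.Lex.toLex_lt_toLex, ofLex_toLex] at hxy hyx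
    exact (Commute.qExpTrunc q n (Commute.qExpTrunc q n (h.commute_diagChain (by omega) (by omega)
      hxy (by omega))).symm).symm

end IsGridRep

/-! ### Formal series modulo powers of the ideal -/

section Quotient

variable {A : Type} [Ring A] [Algebra ℝ A] (I : Ideal A) [I.IsTwoSided] (n : ℕ)

/-- The reduction of formal series modulo `I ^ n`. -/
def reduce : Completion I →ₐ[ℝ] A ⧸ I ^ n :=
  (Pi.evalAlgHom ℝ (fun n : ℕ => A ⧸ I ^ n) n).comp (Completion I).val

omit [Algebra ℝ A] in
-- Elements of the `k`-th power of the image lift to `I ^ k`, which dies in the quotient for `k =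
-- n`.
theorem map_mk_pow_eq_bot : (I.map (Ideal.Quotient.mk (I ^ n))) ^ n = ⊥ := by
  have key : ∀ k, ∀ y ∈ (I.map (Ideal.Quotient.mk (I ^ n))) ^ k,
      ∃ x ∈ I ^ k, Ideal.Quotient.mk (I ^ n) x = y := by
    intro k
    induction k with
    | zero =>
      intro y _
      obtain ⟨x, rfl⟩ := Ideal.Quotient.mk_surjective y
      exact ⟨x, by rw [Submodule.pow_zero, Ideal.one_eq_top]; trivial, rfl⟩
    | succ k ih =>
      intro y hy
      rw [Submodule.pow_succ] at hy
      refine Submodule.mul_induction_on hy (fun a ha b hb => ?_) ?_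
      · obtain ⟨x, hx, rfl⟩ := ih a ha
        obtain ⟨w, hw, rfl⟩ :=
          (Ideal.mem_map_iff_of_surjective _ Ideal.Quotient.mk_surjective).1 hb
        exact ⟨x * w, by rw [Submodule.pow_succ]; exact Ideal.mul_mem_mul hx hw, map_mul _ _ _⟩
      · rintro _ _ ⟨x, hx, rfl⟩ ⟨w, hw, rfl⟩
        exact ⟨x + w, add_mem hx hw, map_add _ _ _⟩
  rw [eq_bot_iff]
  intro y hy
  obtain ⟨x, hx, rfl⟩ := key n y hy
  exact Ideal.Quotient.eq_zero_iff_mem.2 hx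

variable {I}

theorem reduce_qExp (q : ℝ) (x : A) (hx : x ∈ I) :
    reduce I n (qExp I q x hx) = qExpTrunc q n (Ideal.Quotient.mkₐ ℝ (I ^ n) x) := by
  change Ideal.Quotient.mkₐ ℝ (I ^ n) _ = _
  simp [qExpTrunc, map_sum]

theorem exists_reduce_completionAntiMap (f : A →ₐ[ℝ] Aᵐᵒᵖ) (hf : ∀ x ∈ I, unop (f x) ∈ I) :
    ∃ F : (A ⧸ I ^ n) →ₐ[ℝ] (A ⧸ I ^ n)ᵐᵒᵖ,
      (∀ a, F (Ideal.Quotient.mkₐ ℝ (I ^ n) a) = op (Ideal.Quotient.mkₐ ℝ (I ^ n) (unop (f a)))) ∧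
      ∀ x, reduce I n (completionAntiMap f hf x).unop = unop (F (reduce I n x)) :=
  ⟨Ideal.Quotient.liftₐ (I ^ n) ((AlgHom.op (Ideal.Quotient.mkₐ ℝ (I ^ n))).comp f) fun a ha =>
    unop_injective (Ideal.Quotient.eq_zero_iff_mem.2 (antiMap_pow_mem f hf n a ha)),
    fun _ => rfl, fun _ => rfl⟩

theorem reduce_completionMap (f : A →ₐ[ℝ] A) (hf : ∀ x ∈ I, f x ∈ I) {x : Completion I} {a : A}
    (ha : reduce I n x = Ideal.Quotient.mkₐ ℝ (I ^ n) a) :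
    reduce I n (completionMap f hf x) = Ideal.Quotient.mkₐ ℝ (I ^ n) (f a) := by
  change Ideal.Quotient.liftₐ (I ^ n) ((Ideal.Quotient.mkₐ ℝ (I ^ n)).comp f)
    (fun a ha => Ideal.Quotient.eq_zero_iff_mem.2 (map_pow_mem f hf n a ha)) (reduce I n x) = _
  rw [ha]
  rfl

theorem map_diagChain {R S : Type*} [Ring R] [Algebra ℝ R] [Ring S] [Algebra ℝ S]
    (F : R →ₐ[ℝ] S) (z : ℕ → ℕ → R) (m a b : ℕ) :
    F (diagChain z m a b) = diagChain (fun i j => F (z i j)) m a b := by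
  induction m generalizing a b with
  | zero => exact map_one F
  | succ m ih => rw [diagChain, diagChain, map_mul, ih]

theorem map_orderedProd {ι M M' : Type*} [LinearOrder ι] [Monoid M] [Monoid M'] (φ : M →* M')
    (s : Finset ι) (f : {i // i ∈ s} → M) :
    φ (orderedProd s f) = orderedProd s fun x => φ (f x) := by
  rw [orderedProd, map_list_prod, List.map_map]
  rfl

theorem prod_range_map_diag {R : Type*} [Monoid R] (z : ℕ → ℕ → R) (m a b : ℕ) :
    ((List.range m).map fun k => z (a + k) (b + k)).prod = diagChain z m a b := by
  induction m with
  | zero => rfl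
  | succ m ih => rw [List.range_succ, diagChain_succ', ← ih]; simp

end Quotient

/-! ### The generators modulo powers of the augmentation ideal -/

/-- The vertex `(i, j)`. -/
def mkVertex {N i j : ℕ} (h : 1 ≤ i ∧ i < j ∧ j ≤ N) : Vertex N := ⟨(i, j), h⟩

/-- The generators, continued by zero outside the triangle. -/
def gridZ (q : ℝ) (N i j : ℕ) : QuiverAlg q N :=
  if h : 1 ≤ i ∧ i < j ∧ j ≤ N then Z q (mkVertex h) else 0

/-- The residue classes of the generators. -/
def quotZ (q : ℝ) (N n i j : ℕ) : QuiverAlg q N ⧸ augIdeal q N ^ n :=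
  Ideal.Quotient.mkₐ ℝ (augIdeal q N ^ n) (gridZ q N i j)

theorem incidence_eq_gridForm {N : ℕ} (v w : Vertex N) :
    incidence v w = gridForm v.1.1 v.1.2 w.1.1 w.1.2 := by
  unfold incidence gridForm Edge
  congr

theorem gridZ_mul_gridZ (q : ℝ) (N i j k l : ℕ) :
    gridZ q N i j * gridZ q N k l = q ^ gridForm i j k l • (gridZ q N k l * gridZ q N i j) := by
  unfold gridZ
  split_ifs with h₁ h₂
  · rw [Z_mul_Z, incidence_eq_gridForm]
    rfl
  all_goals simp

theorem isGridRep_quotZ {q : ℝ} (hq₀ : 0 < q) (hq₁ : q < 1) (N n : ℕ) :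
    IsGridRep q N n ((augIdeal q N).map (Ideal.Quotient.mk (augIdeal q N ^ n))) (quotZ q N n) where
  q_pos := hq₀
  q_lt_one := hq₁
  nilpotent := map_mk_pow_eq_bot _ _
  mem i j := by
    refine Ideal.mem_map_of_mem _ ?_
    unfold gridZ
    split_ifs
    · exact Z_mem_augIdeal q _
    · exact zero_mem _
  eq_zero i j h := by rw [quotZ, gridZ, dif_neg h, map_zero]
  mul_comm i j k l := by
    simp only [quotZ]
    rw [← map_mul, gridZ_mul_gridZ, map_smul, map_mul]

theorem monomial_eq (q : ℝ) {N a b c : ℕ} (h : 1 ≤ a ∧ a < b ∧ b < c ∧ c ≤ N + 1) :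
    monomial q h = diagChain (gridZ q N) (c - b) a b := by
  have hs : (Finset.Icc 0 (c - b - 1)).sort = List.range (c - b) :=
    sort_eq_of_pairwise List.pairwise_lt_range fun x => by
      simp only [List.mem_range, Finset.mem_Icc]; omega
  rw [← prod_range_map_diag, ← hs, ← orderedProd_eq, monomial]
  congr 1
  funext k
  have := Finset.mem_Icc.1 k.2
  rw [gridZ, dif_pos (by omega)]
  rfl

theorem reduce_T (q : ℝ) (N n : ℕ) :
    reduce (augIdeal q N) n (T q N) = tetraProd q N n (quotZ q N n) := by
  rw [tetraProd, ← orderedProd_eq, T]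
  refine (map_orderedProd (MonoidHomClass.toMonoidHom (reduce (augIdeal q N) n)) _ _).trans ?_
  congr 1
  funext p
  change reduce (augIdeal q N) n (tetraFactor q N p) = _
  rw [tetraFactor, reduce_qExp, monomial_eq, map_diagChain]
  rfl

theorem series_ext {q : ℝ} {N : ℕ} {x y : QuiverSeries q N}
    (h : ∀ n, reduce (augIdeal q N) n x = reduce (augIdeal q N) n y) : x = y :=
  Subtype.ext (funext h)

theorem antiHomOfVertexMap_Z (q : ℝ) {N : ℕ} (s : Vertex N → Vertex N)
    (hs : ∀ v w, Edge (s v) (s w) ↔ Edge w v) (v : Vertex N) :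
    antiHomOfVertexMap q s hs (Z q v) = op (Z q (s v)) :=
  liftGen_Z _ _ v

theorem homOfVertexMap_Z (q : ℝ) {N : ℕ} (s : Vertex N → Vertex N)
    (hs : ∀ v w, Edge (s v) (s w) ↔ Edge v w) (v : Vertex N) :
    homOfVertexMap q s hs (Z q v) = Z q (s v) :=
  liftGen_Z _ _ v

theorem antiHom_refl₃_gridZ (q : ℝ) (N i j : ℕ) :
    antiHomOfVertexMap q refl₃Vertex edge_refl₃ (gridZ q N i j) =
      op (gridZ q N i (N + 1 + i - j)) := by
  by_cases h : 1 ≤ i ∧ i < j ∧ j ≤ N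
  · rw [gridZ, gridZ, dif_pos h, dif_pos (by omega), antiHomOfVertexMap_Z]
    rfl
  · rw [gridZ, gridZ, dif_neg h, dif_neg (by omega), map_zero, op_zero]

theorem antiHom_refl₂_gridZ (q : ℝ) (N i j : ℕ) :
    antiHomOfVertexMap q refl₂Vertex edge_refl₂ (gridZ q N i j) =
      op (gridZ q N (N + 1 - j) (N + 1 - i)) := by
  by_cases h : 1 ≤ i ∧ i < j ∧ j ≤ N
  · rw [gridZ, gridZ, dif_pos h, dif_pos (by omega), antiHomOfVertexMap_Z]
    rfl
  · rw [gridZ, gridZ, dif_neg h, dif_neg (by omega), map_zero, op_zero]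

theorem exists_reduce_seriesAntiHom (q : ℝ) {N : ℕ} (s : Vertex N → Vertex N)
    (hs : ∀ v w, Edge (s v) (s w) ↔ Edge w v) (n : ℕ) :
    ∃ F : (QuiverAlg q N ⧸ augIdeal q N ^ n) →ₐ[ℝ] (QuiverAlg q N ⧸ augIdeal q N ^ n)ᵐᵒᵖ,
      (∀ a, F (Ideal.Quotient.mkₐ ℝ (augIdeal q N ^ n) a) =
        op (Ideal.Quotient.mkₐ ℝ (augIdeal q N ^ n) (unop (antiHomOfVertexMap q s hs a)))) ∧
      ∀ x, reduce (augIdeal q N) n (seriesAntiHom q s hs x).unop =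
        unop (F (reduce (augIdeal q N) n x)) :=
  exists_reduce_completionAntiMap n _ _

theorem reduce_seriesAntiHom (q : ℝ) {N : ℕ} (s : Vertex N → Vertex N)
    (hs : ∀ v w, Edge (s v) (s w) ↔ Edge w v) {n : ℕ} {x : QuiverSeries q N} {a : QuiverAlg q N}
    (ha : reduce (augIdeal q N) n x = Ideal.Quotient.mkₐ ℝ (augIdeal q N ^ n) a) :
    reduce (augIdeal q N) n (seriesAntiHom q s hs x).unop =
      Ideal.Quotient.mkₐ ℝ (augIdeal q N ^ n) (unop (antiHomOfVertexMap q s hs a)) := by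
  obtain ⟨F, hF, h⟩ := exists_reduce_seriesAntiHom q s hs n
  rw [h, ha, hF, unop_op]

theorem reduce_seriesHom (q : ℝ) {N : ℕ} (s : Vertex N → Vertex N)
    (hs : ∀ v w, Edge (s v) (s w) ↔ Edge v w) {n : ℕ} {x : QuiverSeries q N} {a : QuiverAlg q N}
    (ha : reduce (augIdeal q N) n x = Ideal.Quotient.mkₐ ℝ (augIdeal q N ^ n) a) :
    reduce (augIdeal q N) n (seriesHom q s hs x) =
      Ideal.Quotient.mkₐ ℝ (augIdeal q N ^ n) (homOfVertexMap q s hs a) :=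
  reduce_completionMap n _ _ ha

theorem mu₃_T {q : ℝ} (hq₀ : 0 < q) (hq₁ : q < 1) (N : ℕ) :
    (mu₃ q N (T q N)).unop = T q N := by
  refine series_ext fun n => ?_
  obtain ⟨F, hF, h⟩ := exists_reduce_seriesAntiHom q (N := N) refl₃Vertex edge_refl₃ n
  rw [mu₃, h, reduce_T]
  refine (isGridRep_quotZ hq₀ hq₁ N n).unop_map_tetraProd_of_row F fun i j => ?_
  rw [quotZ, hF, antiHom_refl₃_gridZ, unop_op, quotZ]

theorem mu₂_T {q : ℝ} (hq₀ : 0 < q) (hq₁ : q < 1) (N : ℕ) :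
    (mu₂ q N (T q N)).unop = T q N := by
  refine series_ext fun n => ?_
  obtain ⟨F, hF, h⟩ := exists_reduce_seriesAntiHom q (N := N) refl₂Vertex edge_refl₂ n
  rw [mu₂, h, reduce_T]
  refine (isGridRep_quotZ hq₀ hq₁ N n).unop_map_tetraProd_of_diag F fun i j => ?_
  rw [quotZ, hF, antiHom_refl₂_gridZ, unop_op, quotZ]

/-! ### Compositions of the symmetries -/

/-- On vertices, `(i, j) ↦ (i, N + 1 + i - j) ↦ (j - i, N + 1 - i)`. -/
theorem rho_eq (q : ℝ) (N : ℕ) (x : QuiverSeries q N) :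
    rho q N x = (mu₂ q N (mu₃ q N x).unop).unop := by
  refine series_ext fun n => ?_
  obtain ⟨a, ha⟩ := Ideal.Quotient.mk_surjective (reduce (augIdeal q N) n x)
  have e : homOfVertexMap q rotVertex edge_rot =
      (AlgHom.opComm (antiHomOfVertexMap q (N := N) refl₂Vertex edge_refl₂)).comp
        (antiHomOfVertexMap q refl₃Vertex edge_refl₃) := by
    refine hom_ext fun v => ?_
    change _ = unop (antiHomOfVertexMap q refl₂Vertex edge_refl₂
      (unop (antiHomOfVertexMap q refl₃Vertex edge_refl₃ (Z q v))))
    rw [homOfVertexMap_Z, antiHomOfVertexMap_Z, unop_op, antiHomOfVertexMap_Z, unop_op]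
    congr 1
    have := v.2
    refine Subtype.ext (Prod.ext ?_ ?_) <;> simp only [rotVertex, refl₂Vertex, refl₃Vertex]
    all_goals omega
  rw [rho, mu₂, mu₃, reduce_seriesHom q _ _ ha.symm,
    reduce_seriesAntiHom q _ _ (reduce_seriesAntiHom q _ _ ha.symm), e]
  rfl

theorem mu₁_eq (q : ℝ) (N : ℕ) (x : QuiverSeries q N) :
    (mu₁ q N x).unop = (mu₃ q N (rho q N x)).unop := by
  refine series_ext fun n => ?_
  obtain ⟨a, ha⟩ := Ideal.Quotient.mk_surjective (reduce (augIdeal q N) n x)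
  have e : antiHomOfVertexMap q refl₁Vertex edge_refl₁ =
      (antiHomOfVertexMap q (N := N) refl₃Vertex edge_refl₃).comp
        (homOfVertexMap q rotVertex edge_rot) := by
    refine hom_ext fun v => ?_
    rw [AlgHom.comp_apply, homOfVertexMap_Z, antiHomOfVertexMap_Z, antiHomOfVertexMap_Z]
    congr 2
    have := v.2
    refine Subtype.ext (Prod.ext ?_ ?_) <;> simp only [rotVertex, refl₃Vertex, refl₁Vertex]
    all_goals omega
  rw [rho, mu₁, mu₃, reduce_seriesAntiHom q _ _ ha.symm,
    reduce_seriesAntiHom q _ _ (reduce_seriesHom q _ _ ha.symm), e, AlgHom.comp_apply]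

/-! ### The number of factors -/

theorem card_tetrahedron (N : ℕ) : (tetrahedron N).card = (N + 1).choose 3 := by
  -- Lowering all coordinates by one and fibring over `c`, then `b`, leaves two hockey-stick sums.
  have hs : tetrahedron N = ((Finset.range (N + 1)).sigma fun c =>
      (Finset.range c).sigma fun b => Finset.range b).image fun p =>
        toLex (p.2.2 + 1, toLex (p.2.1 + 1, p.1 + 1)) := by
    ext x
    obtain ⟨a, b, c, rfl⟩ : ∃ a b c, x = toLex (a, toLex (b, c)) := ⟨_, _, _, rfl⟩
    simp only [mem_tetrahedron, Finset.mem_image, Finset.mem_sigma, Finset.mem_range,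
      EmbeddingLike.apply_eq_iff_eq, Prod.mk.injEq]
    constructor
    · intro h
      exact ⟨⟨c - 1, b - 1, a - 1⟩, by dsimp only; omega, by dsimp only; omega⟩
    · rintro ⟨⟨k, j, i⟩, h, h'⟩
      dsimp only at h h'
      omega
  have h2 : ∀ c, ∑ b ∈ Finset.range c, b = c.choose 2 := fun c => by
    rw [Finset.sum_range_id, Nat.choose_two_right]
  have h3 : ∀ m, ∑ c ∈ Finset.range m, c.choose 2 = m.choose 3 := by
    intro m
    induction m with
    | zero => rfl
    | succ m ih => rw [Finset.sum_range_succ, ih, Nat.choose_succ_succ' m 2, add_comm]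
  rw [hs, Finset.card_image_of_injective]
  · simp only [Finset.card_sigma, Finset.card_range, h2, h3]
  · rintro ⟨k, j, i⟩ ⟨k', j', i'⟩ h
    simp only [EmbeddingLike.apply_eq_iff_eq, Prod.mk.injEq, add_left_inj] at h
    obtain ⟨rfl, rfl, rfl⟩ := h
    rfl

end QDilog

end
theorem theorem1 (q : ℝ) (hq₀ : 0 < q) (hq₁ : q < 1) (N : ℕ) (hN : 2 ≤ N) :
    (QDilog.tetrahedron N).card = (N + 1).choose 3 ∧
    QDilog.T q N = (QDilog.mu₁ q N (QDilog.T q N)).unop ∧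
    QDilog.T q N = (QDilog.mu₂ q N (QDilog.T q N)).unop ∧
    QDilog.T q N = (QDilog.mu₃ q N (QDilog.T q N)).unop ∧
    QDilog.T q N = QDilog.rho q N (QDilog.T q N) ∧
    QDilog.T q N = QDilog.rho q N (QDilog.rho q N (QDilog.T q N)) := by
  have h₂ := QDilog.mu₂_T hq₀ hq₁ N
  have h₃ := QDilog.mu₃_T hq₀ hq₁ N
  have hρ : QDilog.rho q N (QDilog.T q N) = QDilog.T q N := by rw [QDilog.rho_eq, h₃, h₂]
  refine ⟨QDilog.card_tetrahedron N, ?_, h₂.symm, h₃.symm, hρ.symm, by rw [hρ, hρ]⟩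
  rw [QDilog.mu₁_eq, hρ, h₃]
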